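/- **Setting.** Let $X\in\mathbb R^{n\times d}$ with rows $x_1,\dots,x_n$, $Y\in\mathbb R^n$, $\bar X=X/\sqrt n$, $\gamma>0$, $\sigma\ge 0$, $\alpha\in(0,\infty)^d$, and let $L(\beta)=\kappa\sum_{k=1}^n(\langle x_k,\beta\rangle-y_k)^2$ with a fixed normalisation $\kappa>0$. On a filtered probability space let $B$ and $\tilde B$ be independent standard Brownian motions in $\mathbb R^n$ and $\mathbb R^d$, and let $(w_{t,+},w_{t,-})_{t\ge0}$ be a continuous adapted solution, with $w_{0,\pm}=\alpha$, of $$dw_{t,\pm}=\mp\,[\bar X^{T}r(\beta_t)]\circ w_{t,\pm}\,dt\ \pm\Big(2\sqrt{\gamma L(\beta_t)}\,w_{t,\pm}\circ \bar X^{T}dB_t+2\sigma\sqrt{\gamma L(\beta_t)}\,w_{t,\pm}\circ d\tilde B_t\Big),$$ where $\circ$ is the coordinatewise product, $\beta_t=w_{t,+}^2-w_{t,-}^2$ (coordinatewise) and $r(\beta)=(X\beta-Y)/\sqrt n$. For $a\in(0,\infty)^d$ put $$\phi_a(\beta)=\tfrac14\sum_{i=1}^d\Big(\beta_i\,\mathrm{arcsinh}\Big(\frac{\beta_i}{2a_i^2}\Big)-\sqrt{\beta_i^2+4a_i^4}\Big),$$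 let $\alpha_\infty=\alpha\circ\exp\!\big(-2\gamma\sigma^2\int_0^\infty L(\beta_s)ds\big)\circ\exp\!\big(-2\gamma\,\mathrm{diag}(\bar X^T\bar X)\int_0^\infty L(\beta_s)ds\big)$, and let $P$ be the orthogonal projection of $\mathbb R^d$ onto $\mathrm{span}(x_1,\dots,x_n)$. **Proposition 3.** The continuous Itô integral process $R_t=\sigma\int_0^t\sqrt{\gamma L(\beta_s)}\,(1-P)\,d\tilde B_s$ exists, and for almost every $\omega$ in the convergence event, i.e. the event that $\int_0^\infty L(\beta_s)\,ds$ converges and $\beta_t$ converges to some $\beta_\infty$ with $X\beta_\infty=Y$, the following hold. 1. $\alpha_\infty>0$ coordinatewise, and on every bounded convex set $\phi_{\alpha_\infty}$ is $\mu$-strongly convex (i.e. $\phi_{\alpha_\infty}-\frac\mu2\|\cdot\|_2^2$ is convex) for some $\mu>0$. 2. The limit $r_\infty=\sigma\int_0^\infty\sqrt{\gamma L(\beta_s)}\,(1-P)\,d\tilde B_s=\lim_{t\to\infty}R_t$ exists. 3. $\phi_{\alpha_\infty}$ has a unique minimiser $\beta^*_{\alpha_\infty}$ over $\{\beta: X\beta=Y\}$.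 4. For every convex set $S$ that contains $\beta^*_{\alpha_\infty}$ and $\beta_\infty$, and every $\mu>0$ such that $\phi_{\alpha_\infty}$ is $\mu$-strongly convex on $S$, $$\|\beta^*_{\alpha_\infty}-\beta_\infty\|_2\le\frac1\mu\,\|r_\infty\|_2 .$$ -/

import Mathlib

open MeasureTheory ProbabilityTheory Filter Topology
open scoped NNReal Matrix

noncomputable section

namespace NoisyDLN

/-! ### Brownian motion relative to a filtration, and the Itô integral -/

section Ito

variable {Ω : Type*} {mΩ : MeasurableSpace Ω} {ι : Type*}

/-- `W = (W j)_j` is a standard Brownian motion in `ℝ^ι` with respect to the filtration `ℱ`: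
it is adapted, its coordinates are mutually independent real Brownian motions started at `0`,
and every increment after time `s` is independent of `ℱ s`. -/
structure IsBrownian (ℱ : Filtration ℝ≥0 mΩ) (μ : Measure Ω) (W : ι → ℝ≥0 → Ω → ℝ) : Prop where
  adapted : ∀ j, StronglyAdapted ℱ (W j)
  brownian : ∀ j, IsBrownianReal (W j) μ
  indep_coord : iIndepFun (fun j ω (t : ℝ≥0) => W j t ω) μ
  indep_increment : ∀ s t : ℝ≥0, s ≤ t →
    Indep (MeasurableSpace.comap (fun ω j => W j t ω - W j s ω) MeasurableSpace.pi) (ℱ s) μ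

/-- `0 = τ 0 ≤ τ 1 ≤ ⋯ ≤ τ N = t`. -/
structure IsSubdivision (t : ℝ≥0) (N : ℕ) (τ : ℕ → ℝ≥0) : Prop where
  first : τ 0 = 0
  last : τ N = t
  le : ∀ k < N, τ k ≤ τ (k + 1)

/-- The process `I` is (a continuous version of) the Itô integral
`I_t = ∑_j ∫_0^t H^j_s dW^j_s` of the adapted integrand `H` with almost surely continuous paths:
for every `t`, the left-point Riemann sums along any sequence of subdivisions of `[0, t]` with
mesh tending to `0` converge to `I_t` in probability. This determines `I` up to
indistinguishability. -/
structure IsItoIntegral [Fintype ι] (ℱ : Filtration ℝ≥0 mΩ) (μ : Measure Ω)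
    (W H : ι → ℝ≥0 → Ω → ℝ) (I : ℝ≥0 → Ω → ℝ) : Prop where
  integrand_adapted : ∀ j, StronglyAdapted ℱ (H j)
  integrand_continuous : ∀ j, ∀ᵐ ω ∂μ, Continuous fun t => H j t ω
  continuous : ∀ᵐ ω ∂μ, Continuous fun t => I t ω
  tendsto : ∀ (t : ℝ≥0) (N : ℕ → ℕ) (τ : ℕ → ℕ → ℝ≥0),
    (∀ m, IsSubdivision t (N m) (τ m)) →
    (∀ δ : ℝ≥0, 0 < δ → ∀ᶠ m in atTop, ∀ k < N m, τ m (k + 1) - τ m k < δ) →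
    TendstoInMeasure μ
      (fun m ω => ∑ k ∈ Finset.range (N m), ∑ j,
        H j (τ m k) ω * (W j (τ m (k + 1)) ω - W j (τ m k) ω))
      atTop (I t)

end Ito

/-! ### The diagonal linear network -/

section Network

variable {n d : ℕ}

/-- The normalised feature matrix `X / √n`. -/
def normX (X : Matrix (Fin n) (Fin d) ℝ) : Matrix (Fin n) (Fin d) ℝ :=
  (Real.sqrt n)⁻¹ • X

/-- The set of interpolators `{β | X β = Y}`. -/
def interpolators (X : Matrix (Fin n) (Fin d) ℝ) (Y : Fin n → ℝ) :
    Set (EuclideanSpace ℝ (Fin d)) :=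
  {b | X *ᵥ b.ofLp = Y}

/-- The residual `(X β - Y) / √n`; it equals `(X / √n) (β - β')` for any interpolator `β'`. -/
def residual (X : Matrix (Fin n) (Fin d) ℝ) (Y : Fin n → ℝ) (b : EuclideanSpace ℝ (Fin d)) :
    Fin n → ℝ :=
  (Real.sqrt n)⁻¹ • (X *ᵥ b.ofLp - Y)

/-- The square loss `L(β) = κ ∑_k (⟨x_k, β⟩ - y_k)²`, with normalisation constant `κ`. -/
def loss (κ : ℝ) (X : Matrix (Fin n) (Fin d) ℝ) (Y : Fin n → ℝ)
    (b : EuclideanSpace ℝ (Fin d)) : ℝ :=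
  κ * ∑ k, ((X *ᵥ b.ofLp) k - Y k) ^ 2

/-- The hyperbolic entropy
`φ_a(β) = ¼ ∑_i (β_i arcsinh (β_i / (2 a_i²)) - √(β_i² + 4 a_i⁴))`. -/
def phi (a : Fin d → ℝ) (b : EuclideanSpace ℝ (Fin d)) : ℝ :=
  1 / 4 * ∑ i, (b i * Real.arsinh (b i / (2 * a i ^ 2)) - Real.sqrt (b i ^ 2 + 4 * a i ^ 4))

/-- The span of the training inputs `x_1, …, x_n`, i.e. of the rows of `X`. -/
def rowSpan (X : Matrix (Fin n) (Fin d) ℝ) : Submodule ℝ (EuclideanSpace ℝ (Fin d)) :=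
  Submodule.span ℝ (Set.range fun k : Fin n => WithLp.toLp 2 (X k))

/-- The matrix entry `(1 - P)_{i j}`, where `P` is the orthogonal projection onto the span of the
training inputs. -/
def oneSubProj (X : Matrix (Fin n) (Fin d) ℝ) (i j : Fin d) : ℝ :=
  (EuclideanSpace.single j (1 : ℝ) -
    (rowSpan X).starProjection (EuclideanSpace.single j (1 : ℝ))) i

variable {Ω : Type*}

/-- The predictor `β_t = w_{t,+}² - w_{t,-}²` (coordinatewise). -/
def beta (wp wm : ℝ≥0 → Ω → EuclideanSpace ℝ (Fin d)) (t : ℝ≥0) (ω : Ω) :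
    EuclideanSpace ℝ (Fin d) :=
  WithLp.toLp 2 fun i => wp t ω i ^ 2 - wm t ω i ^ 2

/-- The drift coefficient `[(X / √n)ᵀ r(β_t)]_i`. -/
def drift (X : Matrix (Fin n) (Fin d) ℝ) (Y : Fin n → ℝ)
    (wp wm : ℝ≥0 → Ω → EuclideanSpace ℝ (Fin d)) (i : Fin d) (t : ℝ≥0) (ω : Ω) : ℝ :=
  ((normX X)ᵀ *ᵥ residual X Y (beta wp wm t ω)) i

/-- The integrand of the `i`-th coordinate of
`2 √(γ L(β_t)) v_t ∘ ((X / √n)ᵀ dB_t) + 2 σ √(γ L(β_t)) v_t ∘ dB̃_t`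
against the `(n + d)`-dimensional Brownian motion `(B, B̃)`. -/
def noise (κ γ σ : ℝ) (X : Matrix (Fin n) (Fin d) ℝ) (Y : Fin n → ℝ)
    (wp wm v : ℝ≥0 → Ω → EuclideanSpace ℝ (Fin d)) (i : Fin d) :
    Fin n ⊕ Fin d → ℝ≥0 → Ω → ℝ
  | Sum.inl k, t, ω =>
      2 * Real.sqrt (γ * loss κ X Y (beta wp wm t ω)) * v t ω i * normX X k i
  | Sum.inr j, t, ω =>
      2 * σ * Real.sqrt (γ * loss κ X Y (beta wp wm t ω)) * v t ω i * (if j = i then 1 else 0)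

/-- `(w_{t,+}, w_{t,-})_{t ≥ 0}` is a solution, started at `w_{0,±} = α` and driven by `B`
(in `ℝⁿ`) and `B̃` (in `ℝᵈ`), of the stochastic differential equation
`dw_{t,±} = ∓ [(X / √n)ᵀ r(β_t)] ∘ w_{t,±} dt
  ± (2 √(γ L(β_t)) w_{t,±} ∘ ((X / √n)ᵀ dB_t) + 2 σ √(γ L(β_t)) w_{t,±} ∘ dB̃_t)`. -/
structure IsFlow {mΩ : MeasurableSpace Ω} (ℱ : Filtration ℝ≥0 mΩ) (μ : Measure Ω)
    (κ γ σ : ℝ) (α : Fin d → ℝ) (X : Matrix (Fin n) (Fin d) ℝ) (Y : Fin n → ℝ)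
    (B : Fin n → ℝ≥0 → Ω → ℝ) (Bt : Fin d → ℝ≥0 → Ω → ℝ)
    (wp wm : ℝ≥0 → Ω → EuclideanSpace ℝ (Fin d)) : Prop where
  adapted_p : StronglyAdapted ℱ wp
  adapted_m : StronglyAdapted ℱ wm
  continuous_p : ∀ᵐ ω ∂μ, Continuous fun t => wp t ω
  continuous_m : ∀ᵐ ω ∂μ, Continuous fun t => wm t ω
  init_p : ∀ᵐ ω ∂μ, ∀ i, wp 0 ω i = α i
  init_m : ∀ᵐ ω ∂μ, ∀ i, wm 0 ω i = α i
  sde_p : ∀ i, IsItoIntegral ℱ μ (Sum.elim B Bt) (noise κ γ σ X Y wp wm wp i)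
    (fun t ω => wp t ω i - α i
      + ∫ s in (0 : ℝ)..t, drift X Y wp wm i s.toNNReal ω * wp s.toNNReal ω i)
  sde_m : ∀ i, IsItoIntegral ℱ μ (Sum.elim B Bt) (noise κ γ σ X Y wp wm wm i)
    (fun t ω => -(wm t ω i - α i
      - ∫ s in (0 : ℝ)..t, drift X Y wp wm i s.toNNReal ω * wm s.toNNReal ω i))

/-- `ω` is a point of convergence of the flow with limit `b`: the integral `∫_0^∞ L(β_s) ds`
converges and `β_t` converges to the interpolator `b`. -/
structure ConvergesTo (κ : ℝ) (X : Matrix (Fin n) (Fin d) ℝ) (Y : Fin n → ℝ)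
    (wp wm : ℝ≥0 → Ω → EuclideanSpace ℝ (Fin d)) (ω : Ω)
    (b : EuclideanSpace ℝ (Fin d)) : Prop where
  integrable_loss :
    IntegrableOn (fun s : ℝ => loss κ X Y (beta wp wm s.toNNReal ω)) (Set.Ioi 0) volume
  tendsto : Tendsto (fun t => beta wp wm t ω) atTop (𝓝 b)
  interpolates : b ∈ interpolators X Y

/-- The effective initialisation at infinity
`α_∞ = α ∘ exp (-2 γ σ² ∫_0^∞ L(β_s) ds) ∘ exp (-2 γ diag(XᵀX / n) ∫_0^∞ L(β_s) ds)`. -/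
def alphaInf (κ γ σ : ℝ) (α : Fin d → ℝ) (X : Matrix (Fin n) (Fin d) ℝ) (Y : Fin n → ℝ)
    (wp wm : ℝ≥0 → Ω → EuclideanSpace ℝ (Fin d)) (ω : Ω) (i : Fin d) : ℝ :=
  α i
    * Real.exp (-2 * γ * σ ^ 2
        * ∫ s in Set.Ioi (0 : ℝ), loss κ X Y (beta wp wm s.toNNReal ω))
    * Real.exp (-2 * γ * ((normX X)ᵀ * normX X) i i
        * ∫ s in Set.Ioi (0 : ℝ), loss κ X Y (beta wp wm s.toNNReal ω))

/-- `R` is the process `R_t = σ ∫_0^t √(γ L(β_s)) (1 - P) dB̃_s`. -/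
def IsPerturbation {mΩ : MeasurableSpace Ω} (ℱ : Filtration ℝ≥0 mΩ) (μ : Measure Ω)
    (κ γ σ : ℝ) (X : Matrix (Fin n) (Fin d) ℝ) (Y : Fin n → ℝ)
    (Bt : Fin d → ℝ≥0 → Ω → ℝ) (wp wm : ℝ≥0 → Ω → EuclideanSpace ℝ (Fin d))
    (R : ℝ≥0 → Ω → EuclideanSpace ℝ (Fin d)) : Prop :=
  ∀ i, IsItoIntegral ℱ μ Bt
    (fun j t ω => σ * Real.sqrt (γ * loss κ X Y (beta wp wm t ω)) * oneSubProj X i j)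
    (fun t ω => R t ω i)

/-- `b` is a minimiser of `f` over `{β | X β = Y}`. -/
def IsConstrainedMin (X : Matrix (Fin n) (Fin d) ℝ) (Y : Fin n → ℝ)
    (f : EuclideanSpace ℝ (Fin d) → ℝ) (b : EuclideanSpace ℝ (Fin d)) : Prop :=
  b ∈ interpolators X Y ∧ IsMinOn f (interpolators X Y) b

end Network

end NoisyDLN

end

open NoisyDLN

/-!
The perturbation process has a closed form: along almost every path
`R_t = (1 - P) ∇φ_{α_t}(β_t)`, where `α_t` is `α_∞` with the integrals stopped at time `t`, and
`∇φ_a(β) = ¼ arcsinh (β / (2 a²))`. Every claim about `R` follows from this identity: the right-hand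
side is a continuous process, so the Itô integral exists without being constructed, and it
converges together with `∫_0^t L(β_s) ds` and `β_t`, with limit
`r_∞ = (1 - P) ∇φ_{α_∞}(β_∞)`.

*The closed form.* The martingale parts of `w_{t,+}` and `w_{t,-}` cancel in their product, and
Itô's product rule (`IsItoProcess.mul_eq`) turns `w_{t,+} w_{t,-}` into the solution of a linear
ordinary differential equation, which is `α_t²` (`IsFlow.mul_eq_alphaAt_sq`). In particular
`w_{t,±}` stay positive, and `arcsinh (β_t / (2 α_t²)) = log w_{t,+} - log w_{t,-}`. Itô's formula
for `log w_{t,+}` (`IsItoProcess.tendsto_log`) then identifies the stochastic integral of the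
relative noise with `2 ∇φ_{α_t}(β_t)` plus the integrated drift
(`IsFlow.tendsto_sum_relNoise`). Both the drift and the noise `Xᵀ dB` lie in the row span of `X`,
so `1 - P` removes them and only `R_t` is left.

*Itô calculus.* An Itô integral is a limit in probability of left-point Riemann sums, so the two
Itô formulas come down to three limits along refining subdivisions: the local errors
`I_{τ (k+1)} - I_{τ k} - ∑ⱼ Gʲ ΔWʲ` of an Itô integral sum to zero against adapted weights
(`IsItoIntegral.tendsto_sum_mul_itoError`), they have vanishing quadratic variation
(`IsItoIntegral.tendsto_sum_itoError_sq`), and `ΔWⁱ ΔWʲ` may be replaced by `δᵢⱼ Δt`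
(`IsBrownian.tendsto_sum_compensated`). After truncation of the integrands, which costs an event of
small probability, all of these are sums of orthogonal martingale differences and are estimated in
`L²`. Pathwise arguments along almost surely convergent subsequences do the rest.

*Convex analysis.* The entropy is coercive, and its second derivative is positive and bounded
below on bounded sets, so it has a unique minimiser `β*` over the interpolators, where the gradient
is orthogonal to the kernel of `X`. As `β* - β_∞` lies in that kernel, adding the first-order strong
convexity inequalities at `β*` and `β_∞` gives `μ ‖β* - β_∞‖² ≤ -⟨r_∞, β* - β_∞⟩`
(`norm_sub_le_of_isConstrainedMin`).
-/

namespace NoisyDLN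

/-! ### Martingale differences and Brownian increments -/

section MartingaleDifferences

variable {Ω : Type*} {mΩ : MeasurableSpace Ω} {μ : Measure Ω} {ℱ : Filtration ℝ≥0 mΩ}

/-- `D` is a square-integrable martingale difference over `[s, t]`: it is known at time `t` and
orthogonal in `L²` to everything that is known at time `s`. -/
structure IsMartDiff (ℱ : Filtration ℝ≥0 mΩ) (μ : Measure Ω) (s t : ℝ≥0) (D : Ω → ℝ) : Prop where
  stronglyMeasurable : StronglyMeasurable[ℱ t] D
  memLp : MemLp D 2 μ
  integral_mul : ∀ ξ : Ω → ℝ, StronglyMeasurable[ℱ s] ξ → MemLp ξ 2 μ → ∫ ω, ξ ω * D ω ∂μ = 0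

namespace IsMartDiff

variable {s t u : ℝ≥0} {D E : Ω → ℝ}

lemma zero (s t : ℝ≥0) : IsMartDiff ℱ μ s t (fun _ => 0) :=
  ⟨stronglyMeasurable_const, MemLp.zero, by simp⟩

lemma trans (hD : IsMartDiff ℱ μ s u D) (hE : IsMartDiff ℱ μ u t E) (hsu : s ≤ u) (hut : u ≤ t) :
    IsMartDiff ℱ μ s t (fun ω => D ω + E ω) where
  stronglyMeasurable := (hD.stronglyMeasurable.mono (ℱ.mono hut)).add hE.stronglyMeasurable
  memLp := hD.memLp.add hE.memLp
  integral_mul ξ hξ hξ2 := by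
    have h1 : Integrable (fun ω => ξ ω * D ω) μ := hξ2.integrable_mul hD.memLp
    have h2 : Integrable (fun ω => ξ ω * E ω) μ := hξ2.integrable_mul hE.memLp
    simp only [mul_add]
    rw [integral_add h1 h2,
      hD.integral_mul ξ hξ hξ2, hE.integral_mul ξ (hξ.mono (ℱ.mono hsu)) hξ2, add_zero]

lemma add (hD : IsMartDiff ℱ μ s t D) (hE : IsMartDiff ℱ μ s t E) :
    IsMartDiff ℱ μ s t (fun ω => D ω + E ω) where
  stronglyMeasurable := hD.stronglyMeasurable.add hE.stronglyMeasurable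
  memLp := hD.memLp.add hE.memLp
  integral_mul ξ hξ hξ2 := by
    have h1 : Integrable (fun ω => ξ ω * D ω) μ := hξ2.integrable_mul hD.memLp
    have h2 : Integrable (fun ω => ξ ω * E ω) μ := hξ2.integrable_mul hE.memLp
    simp only [mul_add]
    rw [integral_add h1 h2,
      hD.integral_mul ξ hξ hξ2, hE.integral_mul ξ hξ hξ2, add_zero]

lemma finset_sum {ι : Type*} (S : Finset ι) {D : ι → Ω → ℝ}
    (hD : ∀ j ∈ S, IsMartDiff ℱ μ s t (D j)) :
    IsMartDiff ℱ μ s t (fun ω => ∑ j ∈ S, D j ω) := by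
  classical
  induction S using Finset.induction_on with
  | empty => simpa using IsMartDiff.zero s t
  | insert a S ha ih =>
    simp only [Finset.sum_insert ha]
    exact (hD a (by simp)).add (ih fun j hj => hD j (by simp [hj]))

lemma bdd_mul (hD : IsMartDiff ℱ μ s t D) (hst : s ≤ t) {φ : Ω → ℝ} {C : ℝ}
    (hφ : StronglyMeasurable[ℱ s] φ) (hC : ∀ ω, |φ ω| ≤ C) :
    IsMartDiff ℱ μ s t (fun ω => φ ω * D ω) where
  stronglyMeasurable := (hφ.mono (ℱ.mono hst)).mul hD.stronglyMeasurable
  memLp := by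
    refine (hD.memLp.const_mul C).of_le
      ((hφ.mono (ℱ.le s)).mul (hD.stronglyMeasurable.mono (ℱ.le t))).aestronglyMeasurable
      (Eventually.of_forall fun ω => ?_)
    simp only [Real.norm_eq_abs, abs_mul]
    exact mul_le_mul_of_nonneg_right ((hC ω).trans (le_abs_self C)) (abs_nonneg _)
  integral_mul ξ hξ hξ2 := by
    have h := hD.integral_mul (fun ω => ξ ω * φ ω) (hξ.mul hφ) (by
      refine (hξ2.const_mul C).of_le
        ((hξ.mul hφ).mono (ℱ.le s)).aestronglyMeasurable (Eventually.of_forall fun ω => ?_)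
      simp only [Real.norm_eq_abs, abs_mul]
      rw [mul_comm]
      exact mul_le_mul_of_nonneg_right ((hC ω).trans (le_abs_self C)) (abs_nonneg _))
    simpa only [mul_assoc] using h

/-- Pythagoras for martingale differences over consecutive intervals. -/
lemma sum_range {n : ℕ} {τ : ℕ → ℝ≥0} {D : ℕ → Ω → ℝ} (hτ : ∀ k < n, τ k ≤ τ (k + 1))
    (hD : ∀ k < n, IsMartDiff ℱ μ (τ k) (τ (k + 1)) (D k)) :
    τ 0 ≤ τ n ∧ IsMartDiff ℱ μ (τ 0) (τ n) (fun ω => ∑ k ∈ Finset.range n, D k ω) ∧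
      ∫ ω, (∑ k ∈ Finset.range n, D k ω) ^ 2 ∂μ
        = ∑ k ∈ Finset.range n, ∫ ω, D k ω ^ 2 ∂μ := by
  induction n with
  | zero => exact ⟨le_rfl, by simpa using IsMartDiff.zero (τ 0) (τ 0), by simp⟩
  | succ n ih =>
    obtain ⟨h0, h1, h2⟩ := ih (fun k hk => hτ k (by omega)) (fun k hk => hD k (by omega))
    have hn := hD n (by omega)
    have hle := hτ n (by omega)
    refine ⟨h0.trans hle, ?_, ?_⟩
    · simp only [Finset.sum_range_succ]
      exact h1.trans hn h0 hle
    · simp only [Finset.sum_range_succ, add_sq]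
      have hc : ∫ ω, 2 * (∑ k ∈ Finset.range n, D k ω) * D n ω ∂μ = 0 := by
        simp only [mul_assoc]
        rw [integral_const_mul, hn.integral_mul _ h1.stronglyMeasurable h1.memLp, mul_zero]
      have hi : Integrable (fun ω => 2 * (∑ k ∈ Finset.range n, D k ω) * D n ω) μ := by
        simp only [mul_assoc]
        exact (h1.memLp.integrable_mul hn.memLp).const_mul 2
      have ha : Integrable (fun ω => (∑ k ∈ Finset.range n, D k ω) ^ 2) μ := h1.memLp.integrable_sq
      have hb : Integrable (fun ω => D n ω ^ 2) μ := hn.memLp.integrable_sq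
      rw [integral_add (ha.fun_add hi) hb, integral_add ha hi, hc, h2, add_zero]

end IsMartDiff

end MartingaleDifferences

section BrownianIncrements

variable {Ω : Type*} {mΩ : MeasurableSpace Ω} {μ : Measure Ω}
  {ℱ : Filtration ℝ≥0 mΩ} {ι : Type*} {W : ι → ℝ≥0 → Ω → ℝ}

namespace IsBrownian

lemma hasLaw_increment (hW : IsBrownian ℱ μ W) (j : ι) {s t : ℝ≥0} (hst : s ≤ t) :
    HasLaw (fun ω => W j t ω - W j s ω) (gaussianReal 0 (t - s)) μ := by
  have h := (hW.brownian j).toIsPreBrownianReal.hasLaw_sub t s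
  have h2 : nndist (t : ℝ) (s : ℝ) = t - s := by
    apply NNReal.coe_injective
    rw [coe_nndist, Real.dist_eq, NNReal.coe_sub hst, abs_of_nonneg]
    exact sub_nonneg.2 (by exact_mod_cast hst)
  have h3 : (t.1 : ℝ) = (t : ℝ) := rfl
  have h4 : (s.1 : ℝ) = (s : ℝ) := rfl
  rw [h3, h4, h2] at h
  exact h

lemma memLp_increment (hW : IsBrownian ℱ μ W) (j : ι) {s t : ℝ≥0} (hst : s ≤ t) {p : ENNReal}
    (hp : p ≠ ⊤) :
    MemLp (fun ω => W j t ω - W j s ω) p μ := by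
  have hl := hW.hasLaw_increment j hst
  have h := memLp_id_gaussianReal' (μ := 0) (v := t - s) p hp
  rw [← hl.map_eq] at h
  exact h.comp_of_map hl.aemeasurable

lemma integral_increment (hW : IsBrownian ℱ μ W) (j : ι) {s t : ℝ≥0} (hst : s ≤ t) :
    ∫ ω, (W j t ω - W j s ω) ∂μ = 0 := by
  rw [(hW.hasLaw_increment j hst).integral_eq, integral_id_gaussianReal]

lemma integral_increment_sq (hW : IsBrownian ℱ μ W) (j : ι) {s t : ℝ≥0} (hst : s ≤ t) :
    ∫ ω, (W j t ω - W j s ω) ^ 2 ∂μ = t - s := by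
  have h := (hW.hasLaw_increment j hst).variance_eq
  rw [variance_id_gaussianReal, variance_of_integral_eq_zero
    (hW.hasLaw_increment j hst).aemeasurable (hW.integral_increment j hst)] at h
  rw [h, NNReal.coe_sub hst]

lemma integral_increment_pow_four (hW : IsBrownian ℱ μ W) (j : ι) {s t : ℝ≥0} (hst : s ≤ t) :
    ∫ ω, (W j t ω - W j s ω) ^ 4 ∂μ = (∫ x, x ^ 4 ∂gaussianReal 0 1) * ((t : ℝ) - s) ^ 2 := by
  have hl := hW.hasLaw_increment j hst
  have h1 : ∫ ω, (W j t ω - W j s ω) ^ 4 ∂μ = ∫ x, x ^ 4 ∂gaussianReal 0 (t - s) := by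
    rw [← hl.map_eq, integral_map hl.aemeasurable (by fun_prop)]
  have h2 : gaussianReal 0 (t - s) = (gaussianReal 0 1).map (fun x => √(t - s : ℝ≥0) * x) := by
    have := gaussianReal_map_const_mul (μ := 0) (v := 1) (√(t - s : ℝ≥0))
    rw [this]
    congr 1
    · simp
    · ext; simp
  rw [h1, h2, integral_map (by fun_prop) (by fun_prop)]
  simp only [mul_pow]
  rw [integral_const_mul, mul_comm]
  congr 1
  rw [show (4 : ℕ) = 2 * 2 from rfl, pow_mul, Real.sq_sqrt (NNReal.coe_nonneg _),
    NNReal.coe_sub hst]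

lemma integral_increment_mul (hW : IsBrownian ℱ μ W) [DecidableEq ι] (i j : ι) {s t : ℝ≥0}
    (hst : s ≤ t) :
    ∫ ω, (W i t ω - W i s ω) * (W j t ω - W j s ω) ∂μ = if i = j then (t : ℝ) - s else 0 := by
  split_ifs with h
  · subst h
    simpa only [sq] using hW.integral_increment_sq i hst
  · have hm : Measurable (fun f : ℝ≥0 → ℝ => f t - f s) := by fun_prop
    have hi := (hW.indep_coord.indepFun h).comp hm hm
    have h2 := hi.integral_fun_mul_eq_mul_integral
      (hW.hasLaw_increment i hst).aemeasurable.aestronglyMeasurable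
      (hW.hasLaw_increment j hst).aemeasurable.aestronglyMeasurable
    simp only [Function.comp_apply] at h2
    rw [h2]
    have := hW.integral_increment i hst
    simp [this]

lemma stronglyMeasurable_increment (hW : IsBrownian ℱ μ W) (j : ι) {s t : ℝ≥0} (hst : s ≤ t) :
    StronglyMeasurable[ℱ t] (fun ω => W j t ω - W j s ω) :=
  (hW.adapted j t).sub ((hW.adapted j s).mono (ℱ.mono hst))

/-- A function of the increment after time `s` averages out of a product with anything that is
known at time `s`. -/
lemma integral_mul_comp_increment (hW : IsBrownian ℱ μ W) {s t : ℝ≥0} (hst : s ≤ t) {ξ : Ω → ℝ}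
    (hξ : StronglyMeasurable[ℱ s] ξ) {ψ : (ι → ℝ) → ℝ} (hψ : Measurable ψ) :
    ∫ ω, ξ ω * ψ (fun j => W j t ω - W j s ω) ∂μ
      = (∫ ω, ξ ω ∂μ) * ∫ ω, ψ (fun j => W j t ω - W j s ω) ∂μ := by
  have hm : Measurable (fun ω j => W j t ω - W j s ω) :=
    measurable_pi_lambda _ fun j =>
      ((hW.stronglyMeasurable_increment j hst).mono (ℱ.le t)).measurable
  have hi : IndepFun ξ (fun ω => ψ (fun j => W j t ω - W j s ω)) μ := by
    have h := (hW.indep_increment s t hst).symm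
    rw [IndepFun_iff_Indep]
    refine indep_of_indep_of_le_right (indep_of_indep_of_le_left h ?_) ?_
    · exact hξ.measurable.comap_le
    · rw [← Function.comp_def ψ, ← MeasurableSpace.comap_comp]
      exact MeasurableSpace.comap_mono hψ.comap_le
  exact hi.integral_fun_mul_eq_mul_integral (hξ.mono (ℱ.le s)).aestronglyMeasurable
    (hψ.comp hm).aestronglyMeasurable

lemma isMartDiff_increment (hW : IsBrownian ℱ μ W) (j : ι) {s t : ℝ≥0} (hst : s ≤ t) :
    IsMartDiff ℱ μ s t (fun ω => W j t ω - W j s ω) where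
  stronglyMeasurable := hW.stronglyMeasurable_increment j hst
  memLp := hW.memLp_increment j hst (p := 2) (by simp)
  integral_mul ξ hξ _ := by
    rw [hW.integral_mul_comp_increment hst hξ (measurable_pi_apply j),
      hW.integral_increment j hst, mul_zero]

lemma integral_sq_mul_increment_sq (hW : IsBrownian ℱ μ W) (j : ι) {s t : ℝ≥0} (hst : s ≤ t)
    {g : Ω → ℝ} (hg : StronglyMeasurable[ℱ s] g) :
    ∫ ω, (g ω * (W j t ω - W j s ω)) ^ 2 ∂μ = (∫ ω, g ω ^ 2 ∂μ) * (t - s) := by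
  simp only [mul_pow]
  rw [hW.integral_mul_comp_increment hst (ξ := fun ω => g ω ^ 2) (hg.pow 2)
    (ψ := fun x => x j ^ 2) ((measurable_pi_apply j).pow_const 2),
    hW.integral_increment_sq j hst]

/-- The compensated products `ΔWⁱ ΔWʲ - δᵢⱼ Δt` are martingale differences. -/
lemma isMartDiff_increment_mul [IsProbabilityMeasure μ] (hW : IsBrownian ℱ μ W) [DecidableEq ι]
    (i j : ι) {s t : ℝ≥0} (hst : s ≤ t) :
    IsMartDiff ℱ μ s t (fun ω => (W i t ω - W i s ω) * (W j t ω - W j s ω)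
      - if i = j then (t : ℝ) - s else 0) where
  stronglyMeasurable := ((hW.stronglyMeasurable_increment i hst).mul
    (hW.stronglyMeasurable_increment j hst)).sub stronglyMeasurable_const
  memLp := by
    have h : MemLp (fun ω => (W i t ω - W i s ω) * (W j t ω - W j s ω)) 2 μ := by
      have : ENNReal.HolderTriple 4 4 2 := ⟨by
        rw [← two_mul, show (4 : ENNReal) = 2 * 2 by norm_num, ENNReal.mul_inv (by simp) (by simp),
          ← mul_assoc, ENNReal.mul_inv_cancel (by simp) (by simp), one_mul]⟩
      exact MemLp.mul (hW.memLp_increment j hst (p := 4) (by simp))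
        (hW.memLp_increment i hst (p := 4) (by simp))
    exact h.sub (memLp_const _)
  integral_mul ξ hξ hξ2 := by
    have hψ : Measurable (fun x : ι → ℝ => x i * x j - if i = j then (t : ℝ) - s else 0) := by
      fun_prop
    rw [hW.integral_mul_comp_increment hst hξ hψ, integral_sub, hW.integral_increment_mul i j hst]
    · simp
    · exact (hW.memLp_increment i hst (p := 2) (by simp)).integrable_mul
        (hW.memLp_increment j hst (p := 2) (by simp))
    · exact integrable_const _

lemma integral_compensated_sq_le [IsProbabilityMeasure μ] (hW : IsBrownian ℱ μ W) [DecidableEq ι]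
    (i j : ι) {s t : ℝ≥0} (hst : s ≤ t) :
    ∫ ω, ((W i t ω - W i s ω) * (W j t ω - W j s ω)
      - if i = j then (t : ℝ) - s else 0) ^ 2 ∂μ
      ≤ (2 * (∫ x, x ^ 4 ∂gaussianReal 0 1) + 2) * ((t : ℝ) - s) ^ 2 := by
  have h4 : ∀ k, Integrable (fun ω => (W k t ω - W k s ω) ^ 4) μ := fun k => by
    have := (hW.memLp_increment k hst (p := 4) (by simp)).integrable_norm_pow (p := 4) (by norm_num)
    simpa [Even.pow_abs (show Even 4 by decide)] using this
  have hst' : (0 : ℝ) ≤ t - s := sub_nonneg.2 (by exact_mod_cast hst)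
  calc _ ≤ ∫ ω, ((W i t ω - W i s ω) ^ 4 + (W j t ω - W j s ω) ^ 4 + 2 * ((t : ℝ) - s) ^ 2) ∂μ := by
        refine integral_mono (hW.isMartDiff_increment_mul i j hst).memLp.integrable_sq
          (((h4 i).fun_add (h4 j)).fun_add (integrable_const _)) fun ω => ?_
        have key : ∀ a b c d : ℝ, c ^ 2 ≤ d ^ 2 → (a * b - c) ^ 2 ≤ a ^ 4 + b ^ 4 + 2 * d ^ 2 := by
          intro a b c d h
          nlinarith [sq_nonneg (a ^ 2 - b ^ 2), sq_nonneg (a * b + c)]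
        refine key _ _ _ _ ?_
        split_ifs
        · exact le_rfl
        · simpa using sq_nonneg _
    _ = _ := by
        rw [integral_add ((h4 i).fun_add (h4 j)) (integrable_const _), integral_add (h4 i) (h4 j),
          hW.integral_increment_pow_four i hst, hW.integral_increment_pow_four j hst]
        simp
        ring

end IsBrownian

end BrownianIncrements

/-! ### Convergence in probability and localisation -/

section Localisation

variable {Ω : Type*} {mΩ : MeasurableSpace Ω} {μ : Measure Ω}

lemma tendstoInMeasure_zero_of_eventually_le {f : ℕ → Ω → ℝ}
    (h : ∀ ε > 0, ∀ η > 0, ∀ᶠ m in atTop, μ {ω | ε ≤ |f m ω|} ≤ ENNReal.ofReal η) :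
    TendstoInMeasure μ f atTop (fun _ => 0) := by
  rw [tendstoInMeasure_iff_norm]
  intro ε hε
  simp only [sub_zero, Real.norm_eq_abs]
  rw [ENNReal.tendsto_nhds_zero]
  intro η hη
  by_cases hη' : η = ⊤
  · simp [hη']
  · have := h ε hε η.toReal (ENNReal.toReal_pos hη.ne' hη')
    rwa [ENNReal.ofReal_toReal hη'] at this

lemma tendstoInMeasure_sub {f g : ℕ → Ω → ℝ} {f' g' : Ω → ℝ}
    (hf : TendstoInMeasure μ f atTop f') (hg : TendstoInMeasure μ g atTop g') :
    TendstoInMeasure μ (fun m ω => f m ω - g m ω) atTop (fun ω => f' ω - g' ω) := by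
  rw [tendstoInMeasure_iff_norm] at *
  intro ε hε
  have h := (hf (ε / 2) (by positivity)).add (hg (ε / 2) (by positivity))
  rw [add_zero] at h
  refine tendsto_of_tendsto_of_tendsto_of_le_of_le tendsto_const_nhds h (fun _ => zero_le)
    fun m => (measure_mono fun ω hω => ?_).trans (measure_union_le _ _)
  simp only [Set.mem_ofPred_eq, Set.mem_union, Real.norm_eq_abs] at *
  by_contra! hc
  have := abs_sub (f m ω - f' ω) (g m ω - g' ω)
  rw [show f m ω - f' ω - (g m ω - g' ω) = f m ω - g m ω - (f' ω - g' ω) by ring] at this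
  linarith [hc.1, hc.2]

lemma measure_le_abs_le_ofReal [IsFiniteMeasure μ] {S : Ω → ℝ} (hS : MemLp S 2 μ) {ε c : ℝ}
    (hε : 0 < ε) (hc : ∫ ω, S ω ^ 2 ∂μ ≤ ε ^ 2 * c) :
    μ {ω | ε ≤ |S ω|} ≤ ENNReal.ofReal c := by
  have h := mul_meas_ge_le_integral_of_nonneg (μ := μ) (f := fun ω => S ω ^ 2)
    (Eventually.of_forall fun ω => sq_nonneg _) hS.integrable_sq (ε ^ 2)
  have h2 : {ω | ε ^ 2 ≤ S ω ^ 2} = {ω | ε ≤ |S ω|} := by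
    ext ω
    simp only [Set.mem_ofPred_eq]
    rw [← sq_abs (S ω)]
    exact pow_le_pow_iff_left₀ hε.le (abs_nonneg _) two_ne_zero
  rw [h2] at h
  have h3 : μ.real {ω | ε ≤ |S ω|} ≤ c := le_of_mul_le_mul_left (h.trans hc) (by positivity)
  rw [← ENNReal.ofReal_toReal (measure_ne_top μ {ω | ε ≤ |S ω|})]
  exact ENNReal.ofReal_le_ofReal h3

/-- Truncation of a real number at the levels `±N`. -/
def clamp (N x : ℝ) : ℝ := max (-N) (min N x)

lemma continuous_clamp (N : ℝ) : Continuous (clamp N) := by unfold clamp; fun_prop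

lemma abs_clamp_le {N : ℝ} (hN : 0 ≤ N) (x : ℝ) : |clamp N x| ≤ N := by
  rw [abs_le]
  exact ⟨le_max_left _ _, max_le (by linarith) (min_le_left _ _)⟩

lemma clamp_of_abs_le {N x : ℝ} (h : |x| ≤ N) : clamp N x = x := by
  rw [abs_le] at h
  rw [clamp, min_eq_right h.2, max_eq_right h.1]

/-- Finitely many processes with continuous paths are bounded on `[0, t]` by a common
deterministic constant, outside an event of small probability. -/
lemma exists_forall_abs_le_prob [IsFiniteMeasure μ] {ι : Type*} [Finite ι] {G : ι → ℝ≥0 → Ω → ℝ}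
    (hm : ∀ j s, StronglyMeasurable (G j s)) (hc : ∀ j, ∀ᵐ ω ∂μ, Continuous fun s => G j s ω)
    (t : ℝ≥0) {η : ℝ} (hη : 0 < η) :
    ∃ N : ℝ, 0 < N ∧ μ {ω | ¬ ∀ j, ∀ s ≤ t, |G j s ω| ≤ N} ≤ ENNReal.ofReal η := by
  classical
  -- By continuity it suffices to control the paths along a countable dense set of times, which
  -- makes the exceptional events measurable.
  let q := TopologicalSpace.denseSeq ℝ≥0
  let A : ℕ → Set Ω := fun N => {ω | ∃ j, ∃ r, (N : ℝ) < |G j (min t (q r)) ω|}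
  have hA : ∀ N, MeasurableSet (A N) := fun N => by
    have : A N = ⋃ j, ⋃ r, {ω | (N : ℝ) < |G j (min t (q r)) ω|} := by
      ext; simp [A]
    rw [this]
    exact MeasurableSet.iUnion fun j => MeasurableSet.iUnion fun r =>
      measurableSet_lt measurable_const (hm j _).measurable.abs
  have hanti : Antitone A := fun M N hMN ω ⟨j, r, h⟩ =>
    ⟨j, r, lt_of_le_of_lt (by exact_mod_cast hMN) h⟩
  have hc' : ∀ᵐ ω ∂μ, ∀ j, Continuous fun s => G j s ω := ae_all_iff.2 hc
  have hzero : μ (⋂ N, A N) = 0 := by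
    rw [measure_eq_zero_iff_ae_notMem]
    filter_upwards [hc'] with ω hω hmem
    have hb : ∀ j, ∃ C, ∀ s ∈ Set.Icc 0 t, ‖G j s ω‖ ≤ C := fun j =>
      (isCompact_Icc (a := (0 : ℝ≥0)) (b := t)).exists_bound_of_continuousOn (hω j).continuousOn
    choose C hC using hb
    obtain ⟨M, hM⟩ := (Set.finite_range C).bddAbove
    obtain ⟨N, hN⟩ := exists_nat_ge M
    obtain ⟨j, r, hjr⟩ := Set.mem_iInter.1 hmem N
    have h1 := hC j (min t (q r)) ⟨zero_le, min_le_left _ _⟩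
    have h2 := hM ⟨j, rfl⟩
    rw [Real.norm_eq_abs] at h1
    linarith
  have ht := tendsto_measure_iInter_atTop (μ := μ) (fun N => (hA N).nullMeasurableSet) hanti
    ⟨0, measure_ne_top _ _⟩
  rw [hzero] at ht
  have hev := (ENNReal.tendsto_nhds_zero.1 ht) (ENNReal.ofReal η) (by simpa using hη)
  obtain ⟨N, hN, hN0⟩ := (hev.and (eventually_gt_atTop 0)).exists
  refine ⟨N, by exact_mod_cast hN0, le_trans (measure_mono_ae ?_) hN⟩
  filter_upwards [hc'] with ω hω hmem
  by_contra hnot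
  refine hmem fun j s hs => ?_
  have hcl : IsClosed {s : ℝ≥0 | |G j (min t s) ω| ≤ N} :=
    isClosed_le ((hω j).comp (by fun_prop)).abs continuous_const
  have hall := DenseRange.induction_on (TopologicalSpace.denseRange_denseSeq ℝ≥0)
    (p := fun s => |G j (min t s) ω| ≤ N) s hcl (fun r => by
      by_contra! hlt
      exact hnot ⟨j, r, hlt⟩)
  simpa [min_eq_right hs] using hall

/-- A bounded process with continuous paths is uniformly continuous in `L²` on compact time
intervals. -/
lemma exists_modulus_L2 [IsFiniteMeasure μ] {G : ℝ≥0 → Ω → ℝ} {N : ℝ}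
    (hm : ∀ s, StronglyMeasurable (G s)) (hN : ∀ s ω, |G s ω| ≤ N)
    (hc : ∀ᵐ ω ∂μ, Continuous fun s => G s ω) (t : ℝ≥0) {δ : ℝ} (hδ : 0 < δ) :
    ∃ r : ℝ≥0, 0 < r ∧ ∀ a s, a ≤ s → s ≤ t → s - a < r → ∫ ω, (G s ω - G a ω) ^ 2 ∂μ ≤ δ := by
  let F : ℝ≥0 × ℝ≥0 → ℝ := fun p => ∫ ω, (G p.1 ω - G p.2 ω) ^ 2 ∂μ
  have hF : Continuous F := by
    refine continuous_of_dominated (bound := fun _ => (2 * N) ^ 2)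
      (fun p => (((hm p.1).sub (hm p.2)).pow 2).aestronglyMeasurable)
      (fun p => Eventually.of_forall fun ω => ?_) (integrable_const _) ?_
    · rw [Real.norm_eq_abs, abs_of_nonneg (sq_nonneg _), ← sq_abs]
      refine pow_le_pow_left₀ (abs_nonneg _) ((abs_sub _ _).trans ?_) 2
      linarith [hN p.1 ω, hN p.2 ω]
    · filter_upwards [hc] with ω hω
      fun_prop
  have hu := ((isCompact_Icc (a := (0 : ℝ≥0)) (b := t)).prod
    (isCompact_Icc (a := (0 : ℝ≥0)) (b := t))).uniformContinuousOn_of_continuous hF.continuousOn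
  obtain ⟨r, hr, h⟩ := Metric.uniformContinuousOn_iff.1 hu δ hδ
  refine ⟨⟨r, hr.le⟩, hr, fun a s has hst hsa => ?_⟩
  have hdist : dist (s, a) (a, a) < r := by
    rw [Prod.dist_eq, dist_self, max_eq_left dist_nonneg, NNReal.dist_eq,
      abs_of_nonneg (sub_nonneg.2 (by exact_mod_cast has)), ← NNReal.coe_sub has]
    exact hsa
  have h1 := h (s, a) ⟨⟨zero_le, hst⟩, ⟨zero_le, has.trans hst⟩⟩ (a, a)
    ⟨⟨zero_le, has.trans hst⟩, ⟨zero_le, has.trans hst⟩⟩ hdist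
  have h2 : F (a, a) = 0 := by simp [F]
  rw [h2, Real.dist_eq, sub_zero] at h1
  exact (le_abs_self _).trans h1.le

end Localisation

/-! ### Local errors of Riemann sums -/

section Subdivisions

lemma IsSubdivision.le_of_le {t : ℝ≥0} {N : ℕ} {τ : ℕ → ℝ≥0} (h : IsSubdivision t N τ)
    {j k : ℕ} (hjk : j ≤ k) (hk : k ≤ N) : τ j ≤ τ k := by
  induction k, hjk using Nat.le_induction with
  | base => exact le_rfl
  | succ n hn ih => exact (ih (by omega)).trans (h.le n hk)

lemma IsSubdivision.le_last {t : ℝ≥0} {N : ℕ} {τ : ℕ → ℝ≥0} (h : IsSubdivision t N τ)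
    {k : ℕ} (hk : k ≤ N) : τ k ≤ t :=
  (h.le_of_le hk le_rfl).trans_eq h.last

/-- The `l`-th of the points that divide `[a, b]` into `p` equal pieces. -/
noncomputable def equidist (a b : ℝ≥0) (p l : ℕ) : ℝ≥0 := a + l / p * (b - a)

variable {a b : ℝ≥0} {p : ℕ}

lemma equidist_zero : equidist a b p 0 = a := by simp [equidist]

lemma equidist_self (hab : a ≤ b) (hp : p ≠ 0) : equidist a b p p = b := by
  rw [equidist, div_self (by exact_mod_cast hp), one_mul, add_tsub_cancel_of_le hab]

lemma equidist_mono {l m : ℕ} (h : l ≤ m) : equidist a b p l ≤ equidist a b p m := by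
  unfold equidist; gcongr

lemma equidist_succ (l : ℕ) :
    equidist a b p (l + 1) = equidist a b p l + (b - a) / p := by
  simp only [equidist, Nat.cast_add, Nat.cast_one]
  rw [add_div, add_mul, add_assoc, one_div_mul_eq_div]

lemma equidist_succ_sub (l : ℕ) :
    equidist a b p (l + 1) - equidist a b p l = (b - a) / p := by
  rw [equidist_succ, add_tsub_cancel_left]

lemma le_equidist (l : ℕ) : a ≤ equidist a b p l := le_self_add

lemma equidist_le (hab : a ≤ b) (hp : p ≠ 0) {l : ℕ} (hl : l ≤ p) : equidist a b p l ≤ b :=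
  (equidist_mono hl).trans_eq (equidist_self hab hp)

lemma eventually_div_lt (c : ℝ≥0) {δ : ℝ≥0} (hδ : 0 < δ) :
    ∀ᶠ p : ℕ in atTop, c / ((p + 1 : ℕ) : ℝ≥0) < δ := by
  have h : Tendsto (fun p : ℕ => c / ((p + 1 : ℕ) : ℝ≥0)) atTop (𝓝 0) := by
    have := (tendsto_const_div_atTop_nhds_zero_nat (𝕜 := ℝ) (c : ℝ)).comp (tendsto_add_atTop_nat 1)
    rw [← NNReal.tendsto_coe]
    simpa [Function.comp_def] using this
  exact h.eventually (gt_mem_nhds hδ)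

end Subdivisions

section LocalErrors

variable {Ω : Type*} {mΩ : MeasurableSpace Ω} {μ : Measure Ω}
  {ℱ : Filtration ℝ≥0 mΩ} {ι : Type*} [Fintype ι] {W G : ι → ℝ≥0 → Ω → ℝ} {I : ℝ≥0 → Ω → ℝ}

/-- The increment of an Itô integral over `[a, b]` is the limit in probability of the Riemann sums
over equal subdivisions of `[a, b]`. -/
lemma IsItoIntegral.tendsto_increment (hI : IsItoIntegral ℱ μ W G I) {a b : ℝ≥0} (hab : a ≤ b) :
    TendstoInMeasure μ (fun p ω => ∑ l ∈ Finset.range (p + 1), ∑ j,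
      G j (equidist a b (p + 1) l) ω *
        (W j (equidist a b (p + 1) (l + 1)) ω - W j (equidist a b (p + 1) l) ω))
      atTop (fun ω => I b ω - I a ω) := by
  -- `σ p` divides `[0, a]` and then `[a, b]` into `p + 1` equal pieces each.
  let σ : ℕ → ℕ → ℝ≥0 := fun p i => if i ≤ p + 1 then equidist 0 a (p + 1) i
    else equidist a b (p + 1) (i - (p + 1))
  have hσ1 : ∀ p i, i ≤ p + 1 → σ p i = equidist 0 a (p + 1) i := fun p i hi => if_pos hi
  have hσ2 : ∀ p i, σ p (p + 1 + i) = equidist a b (p + 1) i := fun p i => by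
    rcases Nat.eq_zero_or_pos i with rfl | hi
    · rw [add_zero, hσ1 p _ le_rfl, equidist_zero, equidist_self zero_le (Nat.succ_ne_zero p)]
    · simp only [σ]
      rw [if_neg (by omega), Nat.add_sub_cancel_left]
  have hcase : ∀ p k, σ p (k + 1) - σ p k ≤ (a + b) / ((p + 1 : ℕ) : ℝ≥0) ∧
      σ p k ≤ σ p (k + 1) := fun p k => by
    rcases lt_or_ge k (p + 1) with hk | hk
    · rw [hσ1 p k hk.le, hσ1 p (k + 1) hk, equidist_succ_sub]
      exact ⟨by gcongr; simp, equidist_mono (Nat.le_succ k)⟩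
    · obtain ⟨i, rfl⟩ := Nat.exists_eq_add_of_le hk
      rw [add_assoc, hσ2, hσ2, equidist_succ_sub]
      exact ⟨by gcongr; exact tsub_le_self.trans le_add_self, equidist_mono (Nat.le_succ i)⟩
  have h1 := hI.tendsto a (fun p => p + 1) (fun p => equidist 0 a (p + 1))
    (fun p => ⟨equidist_zero, equidist_self zero_le (Nat.succ_ne_zero p),
      fun k _ => equidist_mono (Nat.le_succ k)⟩)
    (fun δ hδ => (eventually_div_lt (a - 0) hδ).mono fun p hp k _ => by
      rw [equidist_succ_sub]; exact hp)
  have h2 := hI.tendsto b (fun p => p + 1 + (p + 1)) σ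
    (fun p => ⟨by rw [hσ1 p 0 (Nat.zero_le _), equidist_zero],
      by rw [hσ2, equidist_self hab (Nat.succ_ne_zero p)], fun k _ => (hcase p k).2⟩)
    (fun δ hδ => (eventually_div_lt (a + b) hδ).mono fun p hp k _ =>
      (hcase p k).1.trans_lt hp)
  refine (tendstoInMeasure_sub h2 h1).congr_left fun p => Eventually.of_forall fun ω => ?_
  simp only
  rw [Finset.sum_range_add, Finset.sum_congr rfl (fun i hi => ?_), add_sub_cancel_left]
  · simp only [add_assoc]
    refine Finset.sum_congr rfl fun i _ => ?_
    simp only [← add_assoc, hσ2]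
    rw [show p + 1 + i + 1 = p + 1 + (i + 1) by ring, hσ2]
  · rw [hσ1 p i (Finset.mem_range.1 hi).le, hσ1 p (i + 1) (Finset.mem_range.1 hi)]

/-- The error made on the `k`-th interval of the subdivision `τ` when the increment of the Itô
integral `I` of `G` is replaced by the left-point term `∑ⱼ Gʲ ΔWʲ`. -/
def itoError (W G : ι → ℝ≥0 → Ω → ℝ) (I : ℝ≥0 → Ω → ℝ) (τ : ℕ → ℝ≥0) (k : ℕ) (ω : Ω) : ℝ :=
  I (τ (k + 1)) ω - I (τ k) ω - ∑ j, G j (τ k) ω * (W j (τ (k + 1)) ω - W j (τ k) ω)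

/-- The Riemann sum over `p` equal pieces of `[a, b]`, minus the left-point term. -/
noncomputable def refinedError (W K : ι → ℝ≥0 → Ω → ℝ) (a b : ℝ≥0) (p : ℕ) (ω : Ω) : ℝ :=
  ∑ l ∈ Finset.range p, ∑ j, (K j (equidist a b p l) ω - K j a ω) *
    (W j (equidist a b p (l + 1)) ω - W j (equidist a b p l) ω)

lemma IsItoIntegral.tendsto_refinedError (hI : IsItoIntegral ℱ μ W G I) {τ : ℕ → ℝ≥0} {k : ℕ}
    (hk : τ k ≤ τ (k + 1)) :
    TendstoInMeasure μ (fun p => refinedError W G (τ k) (τ (k + 1)) (p + 1))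
      atTop (itoError W G I τ k) := by
  have hcst : TendstoInMeasure μ
      (fun (_ : ℕ) ω => ∑ j, G j (τ k) ω * (W j (τ (k + 1)) ω - W j (τ k) ω)) atTop
      (fun ω => ∑ j, G j (τ k) ω * (W j (τ (k + 1)) ω - W j (τ k) ω)) := by
    rw [tendstoInMeasure_iff_norm]
    intro ε hε
    simp [not_le.2 hε]
  refine (tendstoInMeasure_sub (hI.tendsto_increment hk) hcst).congr_left
    fun p => Eventually.of_forall fun ω => ?_
  simp only [refinedError, sub_mul, Finset.sum_sub_distrib]
  congr 1
  rw [Finset.sum_comm]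
  refine Finset.sum_congr rfl fun j _ => ?_
  rw [← Finset.mul_sum,
    Finset.sum_range_sub (fun l => W j (equidist (τ k) (τ (k + 1)) (p + 1) l) ω),
    equidist_zero, equidist_self hk (Nat.succ_ne_zero p)]

/-- For a bounded adapted integrand the refined error is a martingale difference, whose variance is
controlled by the `L²` oscillation of the integrand. -/
lemma isMartDiff_refinedError (hW : IsBrownian ℱ μ W) {K : ι → ℝ≥0 → Ω → ℝ} {N : ℝ}
    (hK : ∀ j s, StronglyMeasurable[ℱ s] (K j s)) (hN : ∀ j s ω, |K j s ω| ≤ N)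
    {a b : ℝ≥0} (hab : a ≤ b) {p : ℕ} (hp : p ≠ 0) {δ : ℝ}
    (hδ : ∀ j, ∀ s, a ≤ s → s ≤ b → ∫ ω, (K j s ω - K j a ω) ^ 2 ∂μ ≤ δ) :
    IsMartDiff ℱ μ a b (refinedError W K a b p) ∧
      ∫ ω, refinedError W K a b p ω ^ 2 ∂μ ≤ Fintype.card ι ^ 2 * δ * (b - a) := by
  have hstep : ∀ l, equidist a b p l ≤ equidist a b p (l + 1) :=
    fun l => equidist_mono (Nat.le_succ l)
  have hg : ∀ l j, StronglyMeasurable[ℱ (equidist a b p l)]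
      (fun ω => K j (equidist a b p l) ω - K j a ω) := fun l j =>
    (hK j _).sub ((hK j a).mono (ℱ.mono (le_equidist l)))
  have hD : ∀ l j, IsMartDiff ℱ μ (equidist a b p l) (equidist a b p (l + 1))
      (fun ω => (K j (equidist a b p l) ω - K j a ω) *
        (W j (equidist a b p (l + 1)) ω - W j (equidist a b p l) ω)) := fun l j =>
    (hW.isMartDiff_increment j (hstep l)).bdd_mul (hstep l) (hg l j) (C := N + N)
      (fun ω => (abs_sub _ _).trans (add_le_add (hN _ _ _) (hN _ _ _)))
  obtain ⟨-, h1, h2⟩ := IsMartDiff.sum_range (n := p) (fun l _ => hstep l)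
    (fun l _ => IsMartDiff.finset_sum Finset.univ fun j _ => hD l j)
  rw [equidist_zero, equidist_self hab hp] at h1
  refine ⟨h1, ?_⟩
  unfold refinedError
  rw [h2]
  have hab' : ((b - a : ℝ≥0) : ℝ) = b - a := NNReal.coe_sub hab
  have hterm : ∀ l ∈ Finset.range p, ∫ ω, (∑ j, (K j (equidist a b p l) ω - K j a ω) *
      (W j (equidist a b p (l + 1)) ω - W j (equidist a b p l) ω)) ^ 2 ∂μ
      ≤ Fintype.card ι ^ 2 * δ * ((b - a) / p) := fun l hl => by
    have hsq : ∀ j, Integrable (fun ω => ((K j (equidist a b p l) ω - K j a ω) *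
        (W j (equidist a b p (l + 1)) ω - W j (equidist a b p l) ω)) ^ 2) μ :=
      fun j => (hD l j).memLp.integrable_sq
    have hΔ : (equidist a b p (l + 1) : ℝ) - equidist a b p l = (b - a) / p := by
      rw [← NNReal.coe_sub (hstep l), equidist_succ_sub, NNReal.coe_div, hab']; simp
    calc _ ≤ ∫ ω, Fintype.card ι * ∑ j, ((K j (equidist a b p l) ω - K j a ω) *
          (W j (equidist a b p (l + 1)) ω - W j (equidist a b p l) ω)) ^ 2 ∂μ := by
          refine integral_mono
            (IsMartDiff.finset_sum Finset.univ fun j _ => hD l j).memLp.integrable_sq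
            ((integrable_finsetSum _ fun j _ => hsq j).const_mul _) fun ω => ?_
          exact sq_sum_le_card_mul_sum_sq
      _ = Fintype.card ι * ∑ j, (∫ ω, (K j (equidist a b p l) ω - K j a ω) ^ 2 ∂μ)
            * ((b - a) / p) := by
          rw [integral_const_mul, integral_finsetSum _ fun j _ => hsq j]
          congr 1
          refine Finset.sum_congr rfl fun j _ => ?_
          rw [hW.integral_sq_mul_increment_sq j (hstep l) (hg l j), hΔ]
      _ ≤ Fintype.card ι * ∑ _j : ι, δ * ((b - a) / p) := by
          have : (0 : ℝ) ≤ (b - a) / p := by rw [← hab']; positivity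
          gcongr with j
          exact hδ j _ (le_equidist l) (equidist_le hab hp (Finset.mem_range.1 hl).le)
      _ = _ := by
          rw [Finset.sum_const, Finset.card_univ, nsmul_eq_mul]; ring
  refine (Finset.sum_le_sum hterm).trans_eq ?_
  rw [Finset.sum_const, Finset.card_range, nsmul_eq_mul]
  have : (p : ℝ) ≠ 0 := by exact_mod_cast hp
  field_simp

/-- On a fine subdivision, outside an event of small probability, the local errors of an Itô
integral are arbitrarily close to martingale differences whose variance is small compared with
the length of the interval. -/
lemma IsItoIntegral.exists_isMartDiff_approx [IsProbabilityMeasure μ] (hW : IsBrownian ℱ μ W)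
    (hI : IsItoIntegral ℱ μ W G I) (t : ℝ≥0) {η δ : ℝ} (hη : 0 < η) (hδ : 0 < δ) :
    ∃ r : ℝ≥0, 0 < r ∧ ∀ N τ, IsSubdivision t N τ → (∀ k < N, τ (k + 1) - τ k < r) →
      ∀ ε > 0, ∃ U : ℕ → Ω → ℝ,
        (∀ k < N, IsMartDiff ℱ μ (τ k) (τ (k + 1)) (U k) ∧
          ∫ ω, U k ω ^ 2 ∂μ ≤ δ * (τ (k + 1) - τ k)) ∧
        μ {ω | ∃ k < N, ε ≤ |itoError W G I τ k ω - U k ω|} ≤ ENNReal.ofReal η := by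
  obtain ⟨M, hM, hMμ⟩ := exists_forall_abs_le_prob (μ := μ) (G := G)
    (fun j s => (hI.integrand_adapted j s).mono (ℱ.le s)) hI.integrand_continuous t (half_pos hη)
  let K : ι → ℝ≥0 → Ω → ℝ := fun j s ω => clamp M (G j s ω)
  have hK : ∀ j s, StronglyMeasurable[ℱ s] (K j s) := fun j s =>
    (continuous_clamp M).comp_stronglyMeasurable (hI.integrand_adapted j s)
  have hKM : ∀ j s ω, |K j s ω| ≤ M := fun j s ω => abs_clamp_le hM.le _
  have hKc : ∀ j, ∀ᵐ ω ∂μ, Continuous fun s => K j s ω := fun j =>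
    (hI.integrand_continuous j).mono fun ω h => (continuous_clamp M).comp h
  set δ' : ℝ := δ / (Fintype.card ι ^ 2 + 1) with hδ'
  have hδ'0 : 0 < δ' := by positivity
  have hmod : ∀ j, ∃ r : ℝ≥0, 0 < r ∧ ∀ a s, a ≤ s → s ≤ t → s - a < r →
      ∫ ω, (K j s ω - K j a ω) ^ 2 ∂μ ≤ δ' := fun j =>
    exists_modulus_L2 (fun s => (hK j s).mono (ℱ.le s)) (hKM j) (hKc j) t hδ'0
  choose r hr0 hr using hmod
  obtain ⟨r₀, hr₀, hr₀'⟩ : ∃ r₀ : ℝ≥0, 0 < r₀ ∧ ∀ j, r₀ ≤ r j := by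
    rcases isEmpty_or_nonempty ι with h | h
    · exact ⟨1, one_pos, fun j => h.elim j⟩
    · obtain ⟨j₀, hj₀⟩ := Finite.exists_min r
      exact ⟨r j₀, hr0 j₀, hj₀⟩
  refine ⟨r₀, hr₀, fun N τ hτ hmesh ε hε => ?_⟩
  have hev : ∀ᶠ p : ℕ in atTop, ∀ k ∈ Finset.range N,
      μ {ω | ε ≤ |refinedError W G (τ k) (τ (k + 1)) (p + 1) ω - itoError W G I τ k ω|}
        ≤ ENNReal.ofReal (η / 2 / (N + 1)) := by
    rw [Filter.eventually_all_finset]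
    intro k hk
    have h := hI.tendsto_refinedError (hτ.le k (Finset.mem_range.1 hk))
    rw [tendstoInMeasure_iff_norm] at h
    exact (ENNReal.tendsto_nhds_zero.1 (h ε hε)) _
      (by rw [gt_iff_lt, ENNReal.ofReal_pos]; positivity)
  -- One refinement `p` that serves all `N` intervals; on the event where `G` stays below `M`, the
  -- truncated integrand `K` has the same refined errors as `G`.
  obtain ⟨p, hp⟩ := hev.exists
  refine ⟨fun k => refinedError W K (τ k) (τ (k + 1)) (p + 1), fun k hk => ?_, ?_⟩
  · have hle := hτ.le k hk
    obtain ⟨h1, h2⟩ := isMartDiff_refinedError hW hK hKM hle (Nat.succ_ne_zero p) (δ := δ')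
      (fun j s has hsb => hr j _ _ has (hsb.trans (hτ.le_last hk))
        ((tsub_le_tsub_right hsb _).trans_lt ((hmesh k hk).trans_le (hr₀' j))))
    refine ⟨h1, h2.trans ?_⟩
    have : (0 : ℝ) ≤ τ (k + 1) - τ k := sub_nonneg.2 (by exact_mod_cast hle)
    refine mul_le_mul_of_nonneg_right ?_ this
    rw [hδ', mul_div_assoc', div_le_iff₀ (by positivity)]
    nlinarith
  · calc μ {ω | ∃ k < N, ε ≤ |itoError W G I τ k ω - refinedError W K (τ k) (τ (k + 1)) (p + 1) ω|}
        ≤ μ ({ω | ¬ ∀ j, ∀ s ≤ t, |G j s ω| ≤ M} ∪ ⋃ k ∈ Finset.range N,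
          {ω | ε ≤ |refinedError W G (τ k) (τ (k + 1)) (p + 1) ω - itoError W G I τ k ω|}) := by
          refine measure_mono fun ω ⟨k, hk, hω⟩ => ?_
          by_cases hb : ∀ j, ∀ s ≤ t, |G j s ω| ≤ M
          · right
            simp only [Set.mem_iUnion]
            refine ⟨k, Finset.mem_range.2 hk, ?_⟩
            have hle := hτ.le k hk
            have hkt := hτ.le_last hk
            have : refinedError W K (τ k) (τ (k + 1)) (p + 1) ω
                = refinedError W G (τ k) (τ (k + 1)) (p + 1) ω := by
              refine Finset.sum_congr rfl fun l hl => Finset.sum_congr rfl fun j _ => ?_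
              simp only [K]
              rw [clamp_of_abs_le (hb j _ ((equidist_le hle (Nat.succ_ne_zero p)
                (Finset.mem_range.1 hl).le).trans hkt)), clamp_of_abs_le (hb j _ (hle.trans hkt))]
            rw [this, abs_sub_comm] at hω
            exact hω
          · exact Or.inl hb
      _ ≤ ENNReal.ofReal (η / 2) + ∑ _k ∈ Finset.range N, ENNReal.ofReal (η / 2 / (N + 1)) := by
          refine (measure_union_le _ _).trans (add_le_add hMμ ?_)
          exact (measure_biUnion_finset_le _ _).trans (Finset.sum_le_sum hp)
      _ ≤ ENNReal.ofReal η := by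
          rw [Finset.sum_const, Finset.card_range, nsmul_eq_mul, ← ENNReal.ofReal_natCast,
            ← ENNReal.ofReal_mul (by positivity), ← ENNReal.ofReal_add (by positivity)
            (by positivity)]
          apply ENNReal.ofReal_le_ofReal
          have : (N : ℝ) * (η / 2 / (N + 1)) ≤ η / 2 := by
            rw [mul_div_assoc', div_le_iff₀ (by positivity)]
            nlinarith
          linarith

end LocalErrors

/-! ### Weighted sums of local errors and of Brownian covariations -/

section LimitsInProbability

variable {Ω : Type*} {mΩ : MeasurableSpace Ω} {μ : Measure Ω} [IsProbabilityMeasure μ]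
  {ℱ : Filtration ℝ≥0 mΩ} {ι : Type*} {W G : ι → ℝ≥0 → Ω → ℝ} {I : ℝ≥0 → Ω → ℝ}
  {t : ℝ≥0} {N : ℕ → ℕ} {τ : ℕ → ℕ → ℝ≥0}

lemma IsSubdivision.sum_sub {t : ℝ≥0} {N : ℕ} {τ : ℕ → ℝ≥0} (h : IsSubdivision t N τ) :
    ∑ k ∈ Finset.range N, ((τ (k + 1) : ℝ) - τ k) = t := by
  rw [Finset.sum_range_sub (fun k => (τ k : ℝ)), h.first, h.last]
  simp

lemma IsSubdivision.sub_nonneg {t : ℝ≥0} {N : ℕ} {τ : ℕ → ℝ≥0} (h : IsSubdivision t N τ)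
    {k : ℕ} (hk : k < N) : (0 : ℝ) ≤ τ (k + 1) - τ k :=
  _root_.sub_nonneg.2 (by exact_mod_cast h.le k hk)

/-- Left-point sums of an adapted weight against an Itô integral `I = ∫ G dW` and against the
left-point increments `G ΔW` have the same limit. -/
lemma IsItoIntegral.tendsto_sum_mul_itoError [Fintype ι] (hW : IsBrownian ℱ μ W)
    (hI : IsItoIntegral ℱ μ W G I) {φ : ℝ≥0 → Ω → ℝ} (hφ : ∀ s, StronglyMeasurable[ℱ s] (φ s))
    (hφc : ∀ᵐ ω ∂μ, Continuous fun s => φ s ω)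
    (hτ : ∀ m, IsSubdivision t (N m) (τ m))
    (hmesh : ∀ δ : ℝ≥0, 0 < δ → ∀ᶠ m in atTop, ∀ k < N m, τ m (k + 1) - τ m k < δ) :
    TendstoInMeasure μ
      (fun m ω => ∑ k ∈ Finset.range (N m), φ (τ m k) ω * itoError W G I (τ m) k ω)
      atTop (fun _ => 0) := by
  refine tendstoInMeasure_zero_of_eventually_le fun ε hε η hη => ?_
  have hη3 : 0 < η / 3 := by positivity
  obtain ⟨C, hC, hCμ⟩ := exists_forall_abs_le_prob (μ := μ) (G := fun (_ : Unit) => φ)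
    (fun _ s => (hφ s).mono (ℱ.le s)) (fun _ => hφc) t hη3
  set δ : ℝ := (ε / 2) ^ 2 * (η / 3) / (C ^ 2 * (t + 1)) with hδ
  obtain ⟨r, hr, h⟩ := hI.exists_isMartDiff_approx hW t hη3 (show 0 < δ by positivity)
  filter_upwards [hmesh r hr] with m hm
  set ε' : ℝ := ε / (2 * (C * (N m + 1))) with hε'
  obtain ⟨U, hU, hUμ⟩ := h (N m) (τ m) (hτ m) hm ε' (by positivity)
  have hD : ∀ k < N m, IsMartDiff ℱ μ (τ m k) (τ m (k + 1))
      (fun ω => clamp C (φ (τ m k) ω) * U k ω) := fun k hk =>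
    (hU k hk).1.bdd_mul ((hτ m).le k hk)
      ((continuous_clamp C).comp_stronglyMeasurable (hφ _)) (fun ω => abs_clamp_le hC.le _)
  obtain ⟨-, h1, h2⟩ := IsMartDiff.sum_range (hτ m).le hD
  have hvar : ∫ ω, (∑ k ∈ Finset.range (N m), clamp C (φ (τ m k) ω) * U k ω) ^ 2 ∂μ
      ≤ (ε / 2) ^ 2 * (η / 3) := by
    rw [h2]
    calc _ ≤ ∑ k ∈ Finset.range (N m), C ^ 2 * (δ * (τ m (k + 1) - τ m k)) := by
          refine Finset.sum_le_sum fun k hk => ?_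
          have hk := Finset.mem_range.1 hk
          refine le_trans ?_ (mul_le_mul_of_nonneg_left (hU k hk).2 (sq_nonneg C))
          rw [← integral_const_mul]
          refine integral_mono (hD k hk).memLp.integrable_sq
            ((hU k hk).1.memLp.integrable_sq.const_mul _) fun ω => ?_
          simp only [mul_pow]
          refine mul_le_mul_of_nonneg_right ?_ (sq_nonneg _)
          rw [← sq_abs]
          exact pow_le_pow_left₀ (abs_nonneg _) (abs_clamp_le hC.le _) 2
      _ = C ^ 2 * δ * t := by
          rw [← Finset.mul_sum, ← Finset.mul_sum, (hτ m).sum_sub]; ring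
      _ ≤ C ^ 2 * δ * (t + 1) := by
          have : 0 < δ := by positivity
          gcongr; linarith
      _ = _ := by rw [hδ]; field_simp
  calc μ {ω | ε ≤ |∑ k ∈ Finset.range (N m), φ (τ m k) ω * itoError W G I (τ m) k ω|}
      ≤ μ ({ω | ¬ ∀ _ : Unit, ∀ s ≤ t, |φ s ω| ≤ C} ∪
        ({ω | ∃ k < N m, ε' ≤ |itoError W G I (τ m) k ω - U k ω|} ∪
        {ω | ε / 2 ≤ |∑ k ∈ Finset.range (N m), clamp C (φ (τ m k) ω) * U k ω|})) := by
        refine measure_mono fun ω hω => ?_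
        by_contra hnot
        simp only [Set.mem_union, Set.mem_ofPred_eq, not_or, not_not, not_exists, not_and,
          not_le] at hnot hω
        obtain ⟨hb, he, hs⟩ := hnot
        have hb' : ∀ k < N m, |φ (τ m k) ω| ≤ C := fun k hk => hb () _ ((hτ m).le_last hk.le)
        have hdiff : |∑ k ∈ Finset.range (N m), φ (τ m k) ω * itoError W G I (τ m) k ω
            - ∑ k ∈ Finset.range (N m), clamp C (φ (τ m k) ω) * U k ω| ≤ ε / 2 := by
          rw [← Finset.sum_sub_distrib]
          refine (Finset.abs_sum_le_sum_abs _ _).trans ?_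
          calc _ ≤ ∑ _k ∈ Finset.range (N m), C * ε' := by
                refine Finset.sum_le_sum fun k hk => ?_
                have hk := Finset.mem_range.1 hk
                rw [clamp_of_abs_le (hb' k hk), ← mul_sub, abs_mul]
                exact mul_le_mul (hb' k hk) (he k hk).le (abs_nonneg _) hC.le
            _ = N m * (C * ε') := by rw [Finset.sum_const, Finset.card_range, nsmul_eq_mul]
            _ ≤ (N m + 1) * (C * ε') := by gcongr; linarith
            _ = ε / 2 := by rw [hε']; field_simp
        have := abs_sub_abs_le_abs_sub
          (∑ k ∈ Finset.range (N m), φ (τ m k) ω * itoError W G I (τ m) k ω)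
          (∑ k ∈ Finset.range (N m), clamp C (φ (τ m k) ω) * U k ω)
        linarith
    _ ≤ ENNReal.ofReal (η / 3) + (ENNReal.ofReal (η / 3) + ENNReal.ofReal (η / 3)) := by
        refine (measure_union_le _ _).trans (add_le_add hCμ ((measure_union_le _ _).trans
          (add_le_add hUμ (measure_le_abs_le_ofReal h1.memLp (by positivity) hvar))))
    _ = ENNReal.ofReal η := by
        rw [← ENNReal.ofReal_add hη3.le hη3.le, ← ENNReal.ofReal_add hη3.le (by positivity)]
        congr 1; ring

/-- The local errors of an Itô integral have vanishing quadratic variation. -/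
lemma IsItoIntegral.tendsto_sum_itoError_sq [Fintype ι] (hW : IsBrownian ℱ μ W)
    (hI : IsItoIntegral ℱ μ W G I)
    (hτ : ∀ m, IsSubdivision t (N m) (τ m))
    (hmesh : ∀ δ : ℝ≥0, 0 < δ → ∀ᶠ m in atTop, ∀ k < N m, τ m (k + 1) - τ m k < δ) :
    TendstoInMeasure μ
      (fun m ω => ∑ k ∈ Finset.range (N m), itoError W G I (τ m) k ω ^ 2) atTop (fun _ => 0) := by
  refine tendstoInMeasure_zero_of_eventually_le fun ε hε η hη => ?_
  have hη2 : 0 < η / 2 := by positivity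
  set δ : ℝ := ε / 4 * (η / 2) / (t + 1) with hδ
  obtain ⟨r, hr, h⟩ := hI.exists_isMartDiff_approx hW t hη2 (show 0 < δ by positivity)
  filter_upwards [hmesh r hr] with m hm
  set ε' : ℝ := √(ε / (4 * (N m + 1))) with hε'
  have hε'sq : ε' ^ 2 = ε / (4 * (N m + 1)) := Real.sq_sqrt (by positivity)
  obtain ⟨U, hU, hUμ⟩ := h (N m) (τ m) (hτ m) hm ε' (Real.sqrt_pos.2 (by positivity))
  have hint : ∀ k ∈ Finset.range (N m), Integrable (fun ω => U k ω ^ 2) μ := fun k hk =>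
    (hU k (Finset.mem_range.1 hk)).1.memLp.integrable_sq
  have hmean : ∫ ω, ∑ k ∈ Finset.range (N m), U k ω ^ 2 ∂μ ≤ ε / 4 * (η / 2) := by
    rw [integral_finsetSum _ hint]
    calc _ ≤ ∑ k ∈ Finset.range (N m), δ * ((τ m (k + 1) : ℝ) - τ m k) :=
          Finset.sum_le_sum fun k hk => (hU k (Finset.mem_range.1 hk)).2
      _ = δ * t := by rw [← Finset.mul_sum, (hτ m).sum_sub]
      _ ≤ δ * (t + 1) := by
          have : 0 < δ := by positivity
          gcongr; linarith
      _ = _ := by rw [hδ]; field_simp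
  have hmarkov : μ {ω | ε / 4 ≤ ∑ k ∈ Finset.range (N m), U k ω ^ 2} ≤ ENNReal.ofReal (η / 2) := by
    have h1 := mul_meas_ge_le_integral_of_nonneg (μ := μ)
      (f := fun ω => ∑ k ∈ Finset.range (N m), U k ω ^ 2)
      (Eventually.of_forall fun ω => Finset.sum_nonneg fun k _ => sq_nonneg _)
      (integrable_finsetSum _ hint) (ε / 4)
    have h2 := le_of_mul_le_mul_left (h1.trans hmean) (by positivity)
    rw [← ENNReal.ofReal_toReal
      (measure_ne_top μ {ω | ε / 4 ≤ ∑ k ∈ Finset.range (N m), U k ω ^ 2})]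
    exact ENNReal.ofReal_le_ofReal h2
  calc μ {ω | ε ≤ |∑ k ∈ Finset.range (N m), itoError W G I (τ m) k ω ^ 2|}
      ≤ μ ({ω | ∃ k < N m, ε' ≤ |itoError W G I (τ m) k ω - U k ω|} ∪
        {ω | ε / 4 ≤ ∑ k ∈ Finset.range (N m), U k ω ^ 2}) := by
        refine measure_mono fun ω hω => ?_
        by_contra hnot
        simp only [Set.mem_union, Set.mem_ofPred_eq, not_or, not_exists, not_and, not_le]
          at hnot hω
        obtain ⟨he, hs⟩ := hnot
        rw [abs_of_nonneg (Finset.sum_nonneg fun k _ => sq_nonneg _)] at hω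
        have hle : ∑ k ∈ Finset.range (N m), itoError W G I (τ m) k ω ^ 2
            ≤ ∑ k ∈ Finset.range (N m), (2 * U k ω ^ 2 + 2 * ε' ^ 2) := by
          refine Finset.sum_le_sum fun k hk => ?_
          have h1 : (itoError W G I (τ m) k ω - U k ω) ^ 2 ≤ ε' ^ 2 := by
            rw [← sq_abs]
            exact pow_le_pow_left₀ (abs_nonneg _) (he k (Finset.mem_range.1 hk)).le 2
          nlinarith [sq_nonneg (itoError W G I (τ m) k ω - 2 * U k ω)]
        rw [Finset.sum_add_distrib, ← Finset.mul_sum, Finset.sum_const, Finset.card_range,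
          nsmul_eq_mul, hε'sq] at hle
        have : (N m : ℝ) * (2 * (ε / (4 * (N m + 1)))) ≤ ε / 2 := by
          rw [mul_div_assoc', mul_div_assoc', div_le_div_iff₀ (by positivity) (by positivity)]
          nlinarith
        linarith
    _ ≤ ENNReal.ofReal (η / 2) + ENNReal.ofReal (η / 2) :=
        (measure_union_le _ _).trans (add_le_add hUμ hmarkov)
    _ = ENNReal.ofReal η := by
        rw [← ENNReal.ofReal_add hη2.le hη2.le]; congr 1; ring

/-- `dWⁱ dWʲ = δᵢⱼ dt`, tested against an adapted weight. -/
lemma IsBrownian.tendsto_sum_compensated [DecidableEq ι] (hW : IsBrownian ℱ μ W) (i j : ι)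
    {φ : ℝ≥0 → Ω → ℝ} (hφ : ∀ s, StronglyMeasurable[ℱ s] (φ s))
    (hφc : ∀ᵐ ω ∂μ, Continuous fun s => φ s ω)
    (hτ : ∀ m, IsSubdivision t (N m) (τ m))
    (hmesh : ∀ δ : ℝ≥0, 0 < δ → ∀ᶠ m in atTop, ∀ k < N m, τ m (k + 1) - τ m k < δ) :
    TendstoInMeasure μ
      (fun m ω => ∑ k ∈ Finset.range (N m), φ (τ m k) ω *
        ((W i (τ m (k + 1)) ω - W i (τ m k) ω) * (W j (τ m (k + 1)) ω - W j (τ m k) ω)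
          - if i = j then (τ m (k + 1) : ℝ) - τ m k else 0))
      atTop (fun _ => 0) := by
  refine tendstoInMeasure_zero_of_eventually_le fun ε hε η hη => ?_
  have hη2 : 0 < η / 2 := by positivity
  obtain ⟨C, hC, hCμ⟩ := exists_forall_abs_le_prob (μ := μ) (G := fun (_ : Unit) => φ)
    (fun _ s => (hφ s).mono (ℱ.le s)) (fun _ => hφc) t hη2
  set M : ℝ := 2 * (∫ x, x ^ 4 ∂gaussianReal 0 1) + 2 with hM
  have hM0 : 0 < M := by
    have : 0 ≤ ∫ x, x ^ 4 ∂gaussianReal 0 1 := integral_nonneg fun x => by positivity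
    positivity
  set r : ℝ := ε ^ 2 * (η / 2) / (C ^ 2 * M * (t + 1)) with hr
  have hr0 : 0 < r := by positivity
  filter_upwards [hmesh ⟨r, hr0.le⟩ hr0] with m hm
  have hD : ∀ k < N m, IsMartDiff ℱ μ (τ m k) (τ m (k + 1))
      (fun ω => clamp C (φ (τ m k) ω) *
        ((W i (τ m (k + 1)) ω - W i (τ m k) ω) * (W j (τ m (k + 1)) ω - W j (τ m k) ω)
          - if i = j then (τ m (k + 1) : ℝ) - τ m k else 0)) := fun k hk =>
    (hW.isMartDiff_increment_mul i j ((hτ m).le k hk)).bdd_mul ((hτ m).le k hk)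
      ((continuous_clamp C).comp_stronglyMeasurable (hφ _)) (fun ω => abs_clamp_le hC.le _)
  obtain ⟨-, h1, h2⟩ := IsMartDiff.sum_range (hτ m).le hD
  have hvar : ∫ ω, (∑ k ∈ Finset.range (N m), clamp C (φ (τ m k) ω) *
        ((W i (τ m (k + 1)) ω - W i (τ m k) ω) * (W j (τ m (k + 1)) ω - W j (τ m k) ω)
          - if i = j then (τ m (k + 1) : ℝ) - τ m k else 0)) ^ 2 ∂μ ≤ ε ^ 2 * (η / 2) := by
    rw [h2]
    calc _ ≤ ∑ k ∈ Finset.range (N m), C ^ 2 * (M * (r * ((τ m (k + 1) : ℝ) - τ m k))) := by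
          refine Finset.sum_le_sum fun k hk => ?_
          have hk := Finset.mem_range.1 hk
          have hle := (hτ m).le k hk
          have h0 := (hτ m).sub_nonneg hk
          have hΔ : (τ m (k + 1) : ℝ) - τ m k ≤ r := by
            rw [← NNReal.coe_sub hle]; exact (hm k hk).le
          have h3 : ∫ ω, ((W i (τ m (k + 1)) ω - W i (τ m k) ω) *
              (W j (τ m (k + 1)) ω - W j (τ m k) ω)
              - if i = j then (τ m (k + 1) : ℝ) - τ m k else 0) ^ 2 ∂μ
              ≤ M * (r * ((τ m (k + 1) : ℝ) - τ m k)) := by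
            refine (hW.integral_compensated_sq_le i j hle).trans ?_
            rw [sq]
            gcongr
          refine le_trans ?_ (mul_le_mul_of_nonneg_left h3 (sq_nonneg C))
          rw [← integral_const_mul]
          refine integral_mono (hD k hk).memLp.integrable_sq
            ((hW.isMartDiff_increment_mul i j hle).memLp.integrable_sq.const_mul _) fun ω => ?_
          simp only [mul_pow]
          refine mul_le_mul_of_nonneg_right ?_ (sq_nonneg _)
          rw [← sq_abs]
          exact pow_le_pow_left₀ (abs_nonneg _) (abs_clamp_le hC.le _) 2
      _ = C ^ 2 * M * r * t := by
          rw [← Finset.mul_sum, ← Finset.mul_sum, ← Finset.mul_sum, (hτ m).sum_sub]; ring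
      _ ≤ C ^ 2 * M * r * (t + 1) := by gcongr; linarith
      _ = _ := by rw [hr]; field_simp
  refine le_trans (measure_mono fun ω hω => ?_) ((measure_union_le _ _).trans
    (add_le_add hCμ (measure_le_abs_le_ofReal h1.memLp hε hvar)) |>.trans_eq ?_)
  · by_contra hnot
    simp only [Set.mem_union, Set.mem_ofPred_eq, not_or, not_not, not_le] at hnot hω
    obtain ⟨hb, hs⟩ := hnot
    refine absurd hω (not_le.2 ?_)
    convert hs using 4 with k hk
    rw [clamp_of_abs_le (hb () _ ((hτ m).le_last (Finset.mem_range.1 hk).le))]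
  · rw [← ENNReal.ofReal_add hη2.le hη2.le]; congr 1; ring

end LimitsInProbability

/-! ### Riemann sums along refining subdivisions -/

section Pathwise

/-- A sequence of subdivisions of `[0, t]` whose mesh tends to `0`. -/
structure IsRefining (t : ℝ≥0) (N : ℕ → ℕ) (τ : ℕ → ℕ → ℝ≥0) : Prop where
  subdivision : ∀ m, IsSubdivision t (N m) (τ m)
  mesh : ∀ δ : ℝ≥0, 0 < δ → ∀ᶠ m in atTop, ∀ k < N m, τ m (k + 1) - τ m k < δ

variable {t : ℝ≥0} {N : ℕ → ℕ} {τ : ℕ → ℕ → ℝ≥0}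

lemma isRefining_equidist (t : ℝ≥0) :
    IsRefining t (fun m => m + 1) (fun m => equidist 0 t (m + 1)) where
  subdivision m := ⟨equidist_zero, equidist_self zero_le (Nat.succ_ne_zero m),
    fun k _ => equidist_mono (Nat.le_succ k)⟩
  mesh δ hδ := (eventually_div_lt (t - 0) hδ).mono fun p hp k _ => by
    rw [equidist_succ_sub]; exact hp

namespace IsRefining

lemma comp (h : IsRefining t N τ) {ns : ℕ → ℕ} (hns : StrictMono ns) :
    IsRefining t (fun i => N (ns i)) (fun i => τ (ns i)) :=
  ⟨fun i => h.subdivision (ns i), fun δ hδ => hns.tendsto_atTop.eventually (h.mesh δ hδ)⟩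

/-- The oscillation of a continuous path on the intervals of the subdivisions tends to `0`. -/
lemma eventually_forall_abs_sub_lt (h : IsRefining t N τ) {x : ℝ≥0 → ℝ} (hx : Continuous x)
    {ε : ℝ} (hε : 0 < ε) :
    ∀ᶠ m in atTop, ∀ k < N m, ∀ s, τ m k ≤ s → s ≤ τ m (k + 1) → |x s - x (τ m k)| < ε := by
  have hu := (isCompact_Icc (a := (0 : ℝ≥0)) (b := t)).uniformContinuousOn_of_continuous
    hx.continuousOn
  obtain ⟨r, hr, hr'⟩ := Metric.uniformContinuousOn_iff.1 hu ε hε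
  filter_upwards [h.mesh ⟨r, hr.le⟩ hr] with m hm k hk s hs1 hs2
  have hle := (h.subdivision m).le_last (Nat.succ_le_of_lt hk)
  refine hr' s ⟨zero_le, hs2.trans hle⟩ (τ m k) ⟨zero_le, (hs1.trans hs2).trans hle⟩ ?_
  rw [NNReal.dist_eq, abs_of_nonneg (_root_.sub_nonneg.2 (by exact_mod_cast hs1)),
    ← NNReal.coe_sub hs1]
  exact (tsub_le_tsub_right hs2 _).trans_lt (hm k hk)

lemma tendsto_sum_mul_integral (h : IsRefining t N τ) {φ g : ℝ≥0 → ℝ} (hφ : Continuous φ)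
    (hg : Continuous g) :
    Tendsto (fun m => ∑ k ∈ Finset.range (N m),
      φ (τ m k) * ∫ s in (τ m k : ℝ)..τ m (k + 1), g s.toNNReal) atTop
      (𝓝 (∫ s in (0 : ℝ)..t, φ s.toNNReal * g s.toNNReal)) := by
  have hφ' : Continuous fun s : ℝ => φ s.toNNReal := hφ.comp continuous_real_toNNReal
  have hg' : Continuous fun s : ℝ => g s.toNNReal := hg.comp continuous_real_toNNReal
  have hφg : Continuous fun s : ℝ => φ s.toNNReal * g s.toNNReal := hφ'.mul hg'
  obtain ⟨M, hM⟩ := (isCompact_Icc (a := (0 : ℝ≥0)) (b := t)).exists_bound_of_continuousOn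
    hg.continuousOn
  have hM0 : 0 ≤ M := (norm_nonneg _).trans (hM 0 ⟨le_rfl, zero_le⟩)
  rw [Metric.tendsto_atTop']
  intro ε hε
  have hε' : 0 < ε / ((M + 1) * (t + 1)) := by positivity
  obtain ⟨m₀, hm₀⟩ := eventually_atTop.1 (h.eventually_forall_abs_sub_lt hφ hε')
  refine ⟨m₀, fun m hm => ?_⟩
  have hτ := h.subdivision m
  have hsplit : ∫ s in (0 : ℝ)..t, φ s.toNNReal * g s.toNNReal
      = ∑ k ∈ Finset.range (N m),
        ∫ s in (τ m k : ℝ)..τ m (k + 1), φ s.toNNReal * g s.toNNReal := by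
    rw [intervalIntegral.sum_integral_adjacent_intervals (a := fun k => (τ m k : ℝ))
      (fun k _ => hφg.intervalIntegrable _ _), hτ.first, hτ.last, NNReal.coe_zero]
  rw [hsplit, Real.dist_eq, ← Finset.sum_sub_distrib]
  refine (Finset.abs_sum_le_sum_abs _ _).trans_lt ?_
  calc _ ≤ ∑ k ∈ Finset.range (N m), ε / ((M + 1) * (t + 1)) * M * ((τ m (k + 1) : ℝ) - τ m k) := by
        refine Finset.sum_le_sum fun k hk => ?_
        have hk := Finset.mem_range.1 hk
        have hle := hτ.le k hk
        rw [← intervalIntegral.integral_const_mul, ← intervalIntegral.integral_sub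
          ((hg'.const_mul _).intervalIntegrable _ _) (hφg.intervalIntegrable _ _),
          ← abs_of_nonneg (hτ.sub_nonneg hk), ← Real.norm_eq_abs]
        refine intervalIntegral.norm_integral_le_of_norm_le_const fun s hs => ?_
        rw [Set.uIoc_of_le (by exact_mod_cast hle)] at hs
        have hs1 : τ m k ≤ s.toNNReal := NNReal.le_toNNReal_of_coe_le hs.1.le
        have hs2 : s.toNNReal ≤ τ m (k + 1) := Real.toNNReal_le_iff_le_coe.2 hs.2
        rw [← sub_mul, norm_mul, Real.norm_eq_abs, abs_sub_comm]
        exact mul_le_mul (hm₀ m hm.le k hk _ hs1 hs2).le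
          (hM _ ⟨zero_le, hs2.trans (hτ.le_last hk)⟩) (norm_nonneg _) hε'.le
    _ = ε * (M * t / ((M + 1) * (t + 1))) := by
        rw [← Finset.mul_sum, hτ.sum_sub]; ring
    _ < ε := by
        refine mul_lt_of_lt_one_right hε ?_
        rw [div_lt_one (by positivity)]
        nlinarith [t.coe_nonneg, mul_nonneg hM0 t.coe_nonneg]

lemma tendsto_sum_mul_sub (h : IsRefining t N τ) {φ : ℝ≥0 → ℝ} (hφ : Continuous φ) :
    Tendsto (fun m => ∑ k ∈ Finset.range (N m), φ (τ m k) * ((τ m (k + 1) : ℝ) - τ m k)) atTop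
      (𝓝 (∫ s in (0 : ℝ)..t, φ s.toNNReal)) := by
  simpa using h.tendsto_sum_mul_integral hφ (continuous_const (y := (1 : ℝ)))

/-- The increments of a continuously differentiable path have vanishing quadratic variation. -/
lemma tendsto_sum_integral_sq (h : IsRefining t N τ) {g : ℝ≥0 → ℝ} (hg : Continuous g) :
    Tendsto (fun m => ∑ k ∈ Finset.range (N m),
      (∫ s in (τ m k : ℝ)..τ m (k + 1), g s.toNNReal) ^ 2) atTop (𝓝 0) := by
  have hg' : Continuous fun s : ℝ => g s.toNNReal := hg.comp continuous_real_toNNReal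
  let A : ℝ≥0 → ℝ := fun u => ∫ s in (0 : ℝ)..u, g s.toNNReal
  have hA : Continuous A :=
    (intervalIntegral.continuous_primitive (fun a b => hg'.intervalIntegrable a b) 0).comp
      NNReal.continuous_coe
  have hinc : ∀ m k, ∫ s in (τ m k : ℝ)..τ m (k + 1), g s.toNNReal
      = A (τ m (k + 1)) - A (τ m k) := fun m k => by
    rw [intervalIntegral.integral_interval_sub_left] <;> exact hg'.intervalIntegrable _ _
  -- `∑ (ΔA)² = A_t² - A_0² - 2 ∑ A ΔA`, and `∑ A ΔA` is a Riemann sum for `∫ A dA`.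
  have hsum := h.tendsto_sum_mul_integral hA hg
  have hid : ∀ m, ∑ k ∈ Finset.range (N m), (∫ s in (τ m k : ℝ)..τ m (k + 1), g s.toNNReal) ^ 2
      = A t ^ 2 - 2 * ∑ k ∈ Finset.range (N m),
        A (τ m k) * ∫ s in (τ m k : ℝ)..τ m (k + 1), g s.toNNReal := fun m => by
    have h1 : A t ^ 2 = ∑ k ∈ Finset.range (N m), (A (τ m (k + 1)) ^ 2 - A (τ m k) ^ 2) := by
      rw [Finset.sum_range_sub (fun k => A (τ m k) ^ 2), (h.subdivision m).first,
        (h.subdivision m).last]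
      simp [A]
    rw [h1, Finset.mul_sum, ← Finset.sum_sub_distrib]
    refine Finset.sum_congr rfl fun k _ => ?_
    rw [hinc]; ring
  have hlim : A t ^ 2 = 2 * ∫ s in (0 : ℝ)..t, A s.toNNReal * g s.toNNReal := by
    have hd : ∀ s ∈ Set.uIcc (0 : ℝ) t, HasDerivAt
        (fun u : ℝ => (∫ s in (0 : ℝ)..u, g s.toNNReal) ^ 2)
        (2 * (∫ r in (0 : ℝ)..s, g r.toNNReal) * g s.toNNReal) s := fun s _ => by
      have := (intervalIntegral.integral_hasDerivAt_right (hg'.intervalIntegrable 0 s)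
        hg'.aestronglyMeasurable.stronglyMeasurableAtFilter hg'.continuousAt).fun_pow 2
      simpa using this
    have hcont : Continuous fun s : ℝ => 2 * (∫ r in (0 : ℝ)..s, g r.toNNReal) * g s.toNNReal :=
      (continuous_const.mul (intervalIntegral.continuous_primitive
        (fun a b => hg'.intervalIntegrable a b) 0)).mul hg'
    have hftc := intervalIntegral.integral_eq_sub_of_hasDerivAt hd (hcont.intervalIntegrable _ _)
    rw [← intervalIntegral.integral_const_mul]
    simp only [intervalIntegral.integral_same] at hftc
    rw [show A t ^ 2 = A t ^ 2 - 0 ^ 2 by ring, ← hftc]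
    refine intervalIntegral.integral_congr fun s hs => ?_
    rw [Set.uIcc_of_le t.coe_nonneg] at hs
    simp only [A, Real.coe_toNNReal s hs.1]
    ring
  simp only [hid]
  have := (hsum.const_mul 2).const_sub (A t ^ 2)
  rwa [← hlim, sub_self] at this

end IsRefining

/-- By Cauchy–Schwarz, weighted sums of products vanish in the limit if one factor has vanishing
quadratic variation. -/
lemma tendsto_sum_mul_of_sq {N : ℕ → ℕ} {ψ u v : ℕ → ℕ → ℝ} {C V : ℝ}
    (hψ : ∀ m, ∀ k < N m, |ψ m k| ≤ C)
    (hu : Tendsto (fun m => ∑ k ∈ Finset.range (N m), u m k ^ 2) atTop (𝓝 0))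
    (hv : Tendsto (fun m => ∑ k ∈ Finset.range (N m), v m k ^ 2) atTop (𝓝 V)) :
    Tendsto (fun m => ∑ k ∈ Finset.range (N m), ψ m k * (u m k * v m k)) atTop (𝓝 0) := by
  have hlim : Tendsto (fun m => √(C ^ 2 * (∑ k ∈ Finset.range (N m), u m k ^ 2)
      * ∑ k ∈ Finset.range (N m), v m k ^ 2)) atTop (𝓝 0) := by
    have := ((hu.const_mul (C ^ 2)).mul hv).sqrt
    simpa using this
  refine squeeze_zero_norm (fun m => ?_) hlim
  refine Real.abs_le_sqrt ?_
  calc _ = (∑ k ∈ Finset.range (N m), (ψ m k * u m k) * v m k) ^ 2 := by simp only [mul_assoc]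
    _ ≤ _ := Finset.sum_mul_sq_le_sq_mul_sq _ _ _
    _ ≤ _ := by
        refine mul_le_mul_of_nonneg_right ?_ (Finset.sum_nonneg fun k _ => sq_nonneg _)
        rw [Finset.mul_sum]
        refine Finset.sum_le_sum fun k hk => ?_
        rw [mul_pow, ← sq_abs (ψ m k)]
        exact mul_le_mul_of_nonneg_right
          (pow_le_pow_left₀ (abs_nonneg _) (hψ m k (Finset.mem_range.1 hk)) 2) (sq_nonneg _)

/-- A perturbation of the increments with vanishing quadratic variation does not affect weighted
sums of products of increments. -/
lemma tendsto_sum_mul_mul_of_close {N : ℕ → ℕ} {ψ a b p q : ℕ → ℕ → ℝ} {C P Q L : ℝ}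
    (hψ : ∀ m, ∀ k < N m, |ψ m k| ≤ C)
    (ha : Tendsto (fun m => ∑ k ∈ Finset.range (N m), (a m k - p m k) ^ 2) atTop (𝓝 0))
    (hb : Tendsto (fun m => ∑ k ∈ Finset.range (N m), (b m k - q m k) ^ 2) atTop (𝓝 0))
    (hp : Tendsto (fun m => ∑ k ∈ Finset.range (N m), p m k ^ 2) atTop (𝓝 P))
    (hq : Tendsto (fun m => ∑ k ∈ Finset.range (N m), q m k ^ 2) atTop (𝓝 Q))
    (hpq : Tendsto (fun m => ∑ k ∈ Finset.range (N m), ψ m k * (p m k * q m k)) atTop (𝓝 L)) :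
    Tendsto (fun m => ∑ k ∈ Finset.range (N m), ψ m k * (a m k * b m k)) atTop (𝓝 L) := by
  have h1 := tendsto_sum_mul_of_sq hψ ha hb
  have h2 := tendsto_sum_mul_of_sq hψ ha hq
  have h3 := tendsto_sum_mul_of_sq hψ hb hp
  have h := ((hpq.add h1).add h2).add h3
  simp only [add_zero, ← Finset.sum_add_distrib] at h
  refine h.congr fun m => Finset.sum_congr rfl fun k _ => ?_
  ring

end Pathwise

section Subsequences

variable {Ω : Type*} {mΩ : MeasurableSpace Ω} {μ : Measure Ω}

/-- Finitely many sequences that converge in probability converge almost surely along a common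
subsequence. -/
lemma exists_subseq_forall_tendsto_ae {κ : Type*} [Finite κ] {F : κ → ℕ → Ω → ℝ} {L : κ → Ω → ℝ}
    (hF : ∀ a, TendstoInMeasure μ (F a) atTop (L a)) :
    ∃ ns : ℕ → ℕ, StrictMono ns ∧
      ∀ᵐ ω ∂μ, ∀ a, Tendsto (fun i => F a (ns i) ω) atTop (𝓝 (L a ω)) := by
  classical
  have := Fintype.ofFinite κ
  suffices h : ∀ S : Finset κ, ∃ ns : ℕ → ℕ, StrictMono ns ∧
      ∀ᵐ ω ∂μ, ∀ a ∈ S, Tendsto (fun i => F a (ns i) ω) atTop (𝓝 (L a ω)) by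
    simpa using h Finset.univ
  intro S
  induction S using Finset.induction_on with
  | empty => exact ⟨id, strictMono_id, by simp⟩
  | insert a S _ ih =>
    obtain ⟨ns, hns, h⟩ := ih
    obtain ⟨ms, hms, h'⟩ := ((hF a).comp hns.tendsto_atTop).exists_seq_tendsto_ae
    refine ⟨ns ∘ ms, hns.comp hms, ?_⟩
    filter_upwards [h, h'] with ω h1 h2 b hb
    rcases Finset.mem_insert.1 hb with rfl | hb
    · exact h2
    · exact (h1 b hb).comp hms.tendsto_atTop

/-- Continuous mapping principle: convergence in probability of `f` follows from that of finitely
many sequences `F a`, if pathwise, along every subsequence, convergence of the latter implies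
convergence of the former. -/
lemma tendstoInMeasure_of_subseq [IsFiniteMeasure μ] {κ : Type*} [Finite κ]
    {F : κ → ℕ → Ω → ℝ} {L : κ → Ω → ℝ} {f : ℕ → Ω → ℝ} {g : Ω → ℝ}
    (hf : ∀ m, AEStronglyMeasurable (f m) μ) (hF : ∀ a, TendstoInMeasure μ (F a) atTop (L a))
    (h : ∀ᵐ ω ∂μ, ∀ ns : ℕ → ℕ, StrictMono ns →
      (∀ a, Tendsto (fun i => F a (ns i) ω) atTop (𝓝 (L a ω))) →
      Tendsto (fun i => f (ns i) ω) atTop (𝓝 (g ω))) :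
    TendstoInMeasure μ f atTop g := by
  rw [exists_seq_tendstoInMeasure_atTop_iff hf]
  intro ns hns
  obtain ⟨ms, hms, h'⟩ :=
    exists_subseq_forall_tendsto_ae fun a => (hF a).comp hns.tendsto_atTop
  refine ⟨ms, hms, ?_⟩
  filter_upwards [h, h'] with ω h1 h2
  exact h1 (ns ∘ ms) (hns.comp hms) h2

lemma forall_fin_two_tendstoInMeasure {F₀ F₁ : ℕ → Ω → ℝ} {L₀ L₁ : Ω → ℝ}
    (h₀ : TendstoInMeasure μ F₀ atTop L₀) (h₁ : TendstoInMeasure μ F₁ atTop L₁) (a : Fin 2) :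
    TendstoInMeasure μ (![F₀, F₁] a) atTop (![L₀, L₁] a) := by
  fin_cases a
  exacts [h₀, h₁]

lemma forall_fin_three_tendstoInMeasure {F₀ F₁ F₂ : ℕ → Ω → ℝ} {L₀ L₁ L₂ : Ω → ℝ}
    (h₀ : TendstoInMeasure μ F₀ atTop L₀) (h₁ : TendstoInMeasure μ F₁ atTop L₁)
    (h₂ : TendstoInMeasure μ F₂ atTop L₂) (a : Fin 3) :
    TendstoInMeasure μ (![F₀, F₁, F₂] a) atTop (![L₀, L₁, L₂] a) := by
  fin_cases a
  exacts [h₀, h₁, h₂]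

lemma forall_fin_five_tendstoInMeasure {F₀ F₁ F₂ F₃ F₄ : ℕ → Ω → ℝ} {L₀ L₁ L₂ L₃ L₄ : Ω → ℝ}
    (h₀ : TendstoInMeasure μ F₀ atTop L₀) (h₁ : TendstoInMeasure μ F₁ atTop L₁)
    (h₂ : TendstoInMeasure μ F₂ atTop L₂) (h₃ : TendstoInMeasure μ F₃ atTop L₃)
    (h₄ : TendstoInMeasure μ F₄ atTop L₄) (a : Fin 5) :
    TendstoInMeasure μ (![F₀, F₁, F₂, F₃, F₄] a) atTop (![L₀, L₁, L₂, L₃, L₄] a) := by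
  fin_cases a
  exacts [h₀, h₁, h₂, h₃, h₄]

end Subsequences

/-! ### Calculus of Itô processes -/

section ItoProcesses

variable {Ω : Type*} {mΩ : MeasurableSpace Ω} {μ : Measure Ω}
  {ℱ : Filtration ℝ≥0 mΩ} {ι : Type*} [Fintype ι] {W : ι → ℝ≥0 → Ω → ℝ}

lemma ae_forall_eq_of_continuous {f g : ℝ≥0 → Ω → ℝ} (hf : ∀ᵐ ω ∂μ, Continuous fun t => f t ω)
    (hg : ∀ᵐ ω ∂μ, Continuous fun t => g t ω) (h : ∀ t, ∀ᵐ ω ∂μ, f t ω = g t ω) :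
    ∀ᵐ ω ∂μ, ∀ t, f t ω = g t ω := by
  have hq : ∀ᵐ ω ∂μ, ∀ n, f (TopologicalSpace.denseSeq ℝ≥0 n) ω
      = g (TopologicalSpace.denseSeq ℝ≥0 n) ω := ae_all_iff.2 fun n => h _
  filter_upwards [hf, hg, hq] with ω h1 h2 h3
  refine congrFun (Continuous.ext_on (TopologicalSpace.denseRange_denseSeq ℝ≥0) h1 h2 ?_)
  rintro _ ⟨n, rfl⟩
  exact h3 n

lemma IsItoIntegral.neg {G : ι → ℝ≥0 → Ω → ℝ} {I : ℝ≥0 → Ω → ℝ} (h : IsItoIntegral ℱ μ W G I) :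
    IsItoIntegral ℱ μ W (fun j t ω => -G j t ω) (fun t ω => -I t ω) where
  integrand_adapted j t := (h.integrand_adapted j t).neg
  integrand_continuous j := (h.integrand_continuous j).mono fun ω hω => hω.neg
  continuous := h.continuous.mono fun ω hω => hω.neg
  tendsto t N τ hτ hmesh ε hε := by
    simpa only [neg_mul, Finset.sum_neg_distrib, edist_neg_neg] using h.tendsto t N τ hτ hmesh ε hε

/-- `x` is an Itô process with `dx = ∑ⱼ Gʲ dWʲ + g dt` and initial value `c`. -/
structure IsItoProcess (ℱ : Filtration ℝ≥0 mΩ) (μ : Measure Ω) (W G : ι → ℝ≥0 → Ω → ℝ)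
    (g : ℝ≥0 → Ω → ℝ) (c : ℝ) (x : ℝ≥0 → Ω → ℝ) : Prop where
  adapted : ∀ s, StronglyMeasurable[ℱ s] (x s)
  continuous : ∀ᵐ ω ∂μ, Continuous fun s => x s ω
  drift_continuous : ∀ᵐ ω ∂μ, Continuous fun s => g s ω
  isItoIntegral : IsItoIntegral ℱ μ W G
    (fun t ω => x t ω - c - ∫ s in (0 : ℝ)..t, g s.toNNReal ω)

variable {G G' : ι → ℝ≥0 → Ω → ℝ} {g g' x x' : ℝ≥0 → Ω → ℝ} {c c' : ℝ}
  {t : ℝ≥0} {N : ℕ → ℕ} {τ : ℕ → ℕ → ℝ≥0}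

lemma itoError_eq {τ : ℕ → ℝ≥0} {k : ℕ} {ω : Ω} (hg : Continuous fun s => g s ω) :
    itoError W G (fun t ω => x t ω - c - ∫ s in (0 : ℝ)..t, g s.toNNReal ω) τ k ω
      = x (τ (k + 1)) ω - x (τ k) ω - ∑ j, G j (τ k) ω * (W j (τ (k + 1)) ω - W j (τ k) ω)
        - ∫ s in (τ k : ℝ)..τ (k + 1), g s.toNNReal ω := by
  have hg' : Continuous fun s : ℝ => g s.toNNReal ω := hg.comp continuous_real_toNNReal
  rw [itoError]
  have h := intervalIntegral.integral_interval_sub_left (hg'.intervalIntegrable 0 (τ (k + 1)))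
    (hg'.intervalIntegrable 0 (τ k)) (μ := volume)
  linear_combination -h

lemma sum_compensated [DecidableEq ι] (g g' w : ι → ℝ) (p Δ : ℝ) :
    ∑ a : ι × ι, p * (g a.1 * g' a.2) * (w a.1 * w a.2 - if a.1 = a.2 then Δ else 0)
      + p * (∑ j, g j * g' j) * Δ = p * ((∑ j, g j * w j) * ∑ j, g' j * w j) := by
  have h : p * ((∑ j, g j * w j) * ∑ j, g' j * w j)
      = ∑ a : ι × ι, p * (g a.1 * g' a.2) * (w a.1 * w a.2) := by
    rw [Finset.sum_mul_sum, Fintype.sum_prod_type, Finset.mul_sum]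
    refine Finset.sum_congr rfl fun i _ => ?_
    rw [Finset.mul_sum]
    exact Finset.sum_congr rfl fun j _ => by ring
  have h' : p * (∑ j, g j * g' j) * Δ
      = ∑ a : ι × ι, p * (g a.1 * g' a.2) * (if a.1 = a.2 then Δ else 0) := by
    simp [Fintype.sum_prod_type, Finset.mul_sum, Finset.sum_mul]
  rw [h, h', ← Finset.sum_add_distrib]
  exact Finset.sum_congr rfl fun a _ => by ring

variable [IsProbabilityMeasure μ]

/-- Left-point sums of an adapted weight against `Δx - ∑ⱼ Gʲ ΔWʲ` only see the drift of `x`. -/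
lemma IsItoProcess.tendsto_sum_mul (hW : IsBrownian ℱ μ W) (hx : IsItoProcess ℱ μ W G g c x)
    {φ : ℝ≥0 → Ω → ℝ} (hφ : ∀ s, StronglyMeasurable[ℱ s] (φ s))
    (hφc : ∀ᵐ ω ∂μ, Continuous fun s => φ s ω) (hτ : IsRefining t N τ) :
    TendstoInMeasure μ (fun m ω => ∑ k ∈ Finset.range (N m), φ (τ m k) ω *
      (x (τ m (k + 1)) ω - x (τ m k) ω
        - ∑ j, G j (τ m k) ω * (W j (τ m (k + 1)) ω - W j (τ m k) ω))) atTop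
      (fun ω => ∫ s in (0 : ℝ)..t, φ s.toNNReal ω * g s.toNNReal ω) := by
  have hF := hx.isItoIntegral.tendsto_sum_mul_itoError hW hφ hφc hτ.subdivision hτ.mesh
  have hmx : ∀ s, Measurable (x s) := fun s => ((hx.adapted s).mono (ℱ.le s)).measurable
  have hmφ : ∀ s, Measurable (φ s) := fun s => ((hφ s).mono (ℱ.le s)).measurable
  have hmG : ∀ j s, Measurable (G j s) := fun j s =>
    ((hx.isItoIntegral.integrand_adapted j s).mono (ℱ.le s)).measurable
  have hmW : ∀ j s, Measurable (W j s) := fun j s => ((hW.adapted j s).mono (ℱ.le s)).measurable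
  refine tendstoInMeasure_of_subseq (fun m => Measurable.aestronglyMeasurable (by fun_prop))
    (fun _ : Unit => hF) ?_
  filter_upwards [hφc, hx.drift_continuous] with ω h1 h2 ns hns hall
  have h := (hall ()).add ((hτ.comp hns).tendsto_sum_mul_integral h1 h2)
  rw [zero_add] at h
  refine h.congr fun i => ?_
  rw [← Finset.sum_add_distrib]
  refine Finset.sum_congr rfl fun k _ => ?_
  rw [itoError_eq h2]
  ring

/-- For quadratic purposes `Δx` may be replaced by its left-point martingale part `∑ⱼ Gʲ ΔWʲ`. -/
lemma IsItoProcess.tendsto_sum_sq (hW : IsBrownian ℱ μ W) (hx : IsItoProcess ℱ μ W G g c x)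
    (hτ : IsRefining t N τ) :
    TendstoInMeasure μ (fun m ω => ∑ k ∈ Finset.range (N m), (x (τ m (k + 1)) ω - x (τ m k) ω
        - ∑ j, G j (τ m k) ω * (W j (τ m (k + 1)) ω - W j (τ m k) ω)) ^ 2) atTop
      (fun _ => 0) := by
  have hF := hx.isItoIntegral.tendsto_sum_itoError_sq hW hτ.subdivision hτ.mesh
  have hmx : ∀ s, Measurable (x s) := fun s => ((hx.adapted s).mono (ℱ.le s)).measurable
  have hmG : ∀ j s, Measurable (G j s) := fun j s =>
    ((hx.isItoIntegral.integrand_adapted j s).mono (ℱ.le s)).measurable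
  have hmW : ∀ j s, Measurable (W j s) := fun j s => ((hW.adapted j s).mono (ℱ.le s)).measurable
  refine tendstoInMeasure_of_subseq (fun m => Measurable.aestronglyMeasurable (by fun_prop))
    (fun _ : Unit => hF) ?_
  filter_upwards [hx.drift_continuous] with ω h2 ns hns hall
  have h := ((hall ()).const_mul 2).add (((hτ.comp hns).tendsto_sum_integral_sq h2).const_mul 2)
  rw [mul_zero, add_zero] at h
  refine squeeze_zero (fun i => Finset.sum_nonneg fun k _ => sq_nonneg _) (fun i => ?_) h
  rw [Finset.mul_sum, Finset.mul_sum, ← Finset.sum_add_distrib]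
  refine Finset.sum_le_sum fun k _ => ?_
  rw [itoError_eq h2]
  set a := x (τ (ns i) (k + 1)) ω - x (τ (ns i) k) ω
    - ∑ j, G j (τ (ns i) k) ω * (W j (τ (ns i) (k + 1)) ω - W j (τ (ns i) k) ω)
  set b := ∫ s in (τ (ns i) k : ℝ)..τ (ns i) (k + 1), g s.toNNReal ω
  nlinarith [sq_nonneg (a - 2 * b)]

/-- The quadratic covariation of the left-point increments `∑ⱼ Gʲ ΔWʲ` and `∑ⱼ G'ʲ ΔWʲ`, tested
against an adapted weight. -/
lemma IsBrownian.tendsto_sum_mul_mul (hW : IsBrownian ℱ μ W)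
    (hG : ∀ j s, StronglyMeasurable[ℱ s] (G j s)) (hGc : ∀ j, ∀ᵐ ω ∂μ, Continuous fun s => G j s ω)
    (hG' : ∀ j s, StronglyMeasurable[ℱ s] (G' j s))
    (hGc' : ∀ j, ∀ᵐ ω ∂μ, Continuous fun s => G' j s ω)
    {ψ : ℝ≥0 → Ω → ℝ} (hψ : ∀ s, StronglyMeasurable[ℱ s] (ψ s))
    (hψc : ∀ᵐ ω ∂μ, Continuous fun s => ψ s ω) (hτ : IsRefining t N τ) :
    TendstoInMeasure μ (fun m ω => ∑ k ∈ Finset.range (N m), ψ (τ m k) ω *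
      ((∑ j, G j (τ m k) ω * (W j (τ m (k + 1)) ω - W j (τ m k) ω)) *
        ∑ j, G' j (τ m k) ω * (W j (τ m (k + 1)) ω - W j (τ m k) ω))) atTop
      (fun ω => ∫ s in (0 : ℝ)..t,
        ψ s.toNNReal ω * ∑ j, G j s.toNNReal ω * G' j s.toNNReal ω) := by
  classical
  have hF : ∀ a : ι × ι, TendstoInMeasure μ _ atTop _ := fun a =>
    hW.tendsto_sum_compensated a.1 a.2 (φ := fun s ω => ψ s ω * (G a.1 s ω * G' a.2 s ω))
      (fun s => (hψ s).mul ((hG _ s).mul (hG' _ s)))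
      (by filter_upwards [hψc, hGc a.1, hGc' a.2] with ω h1 h2 h3; fun_prop)
      hτ.subdivision hτ.mesh
  have hmψ : ∀ s, Measurable (ψ s) := fun s => ((hψ s).mono (ℱ.le s)).measurable
  have hmG : ∀ j s, Measurable (G j s) := fun j s => ((hG j s).mono (ℱ.le s)).measurable
  have hmG' : ∀ j s, Measurable (G' j s) := fun j s => ((hG' j s).mono (ℱ.le s)).measurable
  have hmW : ∀ j s, Measurable (W j s) := fun j s => ((hW.adapted j s).mono (ℱ.le s)).measurable
  refine tendstoInMeasure_of_subseq (fun m => Measurable.aestronglyMeasurable (by fun_prop)) hF ?_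
  filter_upwards [hψc, ae_all_iff.2 hGc, ae_all_iff.2 hGc'] with ω h1 h2 h3 ns hns hall
  have hR := (hτ.comp hns).tendsto_sum_mul_sub
    (φ := fun s => ψ s ω * ∑ j, G j s ω * G' j s ω) (by fun_prop)
  have hS := tendsto_finsetSum (Finset.univ : Finset (ι × ι)) fun a _ => hall a
  have h := hS.add hR
  simp only [Finset.sum_const_zero, zero_add] at h
  refine h.congr fun i => ?_
  rw [Finset.sum_comm, ← Finset.sum_add_distrib]
  refine Finset.sum_congr rfl fun k _ => ?_
  exact sum_compensated (fun j => G j (τ (ns i) k) ω) (fun j => G' j (τ (ns i) k) ω)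
    (fun j => W j (τ (ns i) (k + 1)) ω - W j (τ (ns i) k) ω) _ _

/-- The quadratic covariation of two Itô processes, tested against an adapted weight. -/
lemma IsItoProcess.tendsto_sum_mul_mul (hW : IsBrownian ℱ μ W) (hx : IsItoProcess ℱ μ W G g c x)
    (hx' : IsItoProcess ℱ μ W G' g' c' x')
    {ψ : ℝ≥0 → Ω → ℝ} (hψ : ∀ s, StronglyMeasurable[ℱ s] (ψ s))
    (hψc : ∀ᵐ ω ∂μ, Continuous fun s => ψ s ω) (hτ : IsRefining t N τ) :
    TendstoInMeasure μ (fun m ω => ∑ k ∈ Finset.range (N m), ψ (τ m k) ω *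
      ((x (τ m (k + 1)) ω - x (τ m k) ω) * (x' (τ m (k + 1)) ω - x' (τ m k) ω))) atTop
      (fun ω => ∫ s in (0 : ℝ)..t,
        ψ s.toNNReal ω * ∑ j, G j s.toNNReal ω * G' j s.toNNReal ω) := by
  have hG := hx.isItoIntegral.integrand_adapted
  have hGc := hx.isItoIntegral.integrand_continuous
  have hG' := hx'.isItoIntegral.integrand_adapted
  have hGc' := hx'.isItoIntegral.integrand_continuous
  have h1c : ∀ᵐ ω ∂μ, Continuous fun s : ℝ≥0 => (fun (_ : ℝ≥0) (_ : Ω) => (1 : ℝ)) s ω :=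
    Eventually.of_forall fun ω => continuous_const
  have h1 : ∀ s : ℝ≥0, StronglyMeasurable[ℱ s] ((fun (_ : ℝ≥0) (_ : Ω) => (1 : ℝ)) s) :=
    fun s => stronglyMeasurable_const
  have ha := hx.tendsto_sum_sq hW hτ
  have hb := hx'.tendsto_sum_sq hW hτ
  have hp := hW.tendsto_sum_mul_mul hG hGc hG hGc h1 h1c hτ
  have hq := hW.tendsto_sum_mul_mul hG' hGc' hG' hGc' h1 h1c hτ
  have hpq := hW.tendsto_sum_mul_mul hG hGc hG' hGc' hψ hψc hτ
  have hmψ : ∀ s, Measurable (ψ s) := fun s => ((hψ s).mono (ℱ.le s)).measurable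
  have hmx : ∀ s, Measurable (x s) := fun s => ((hx.adapted s).mono (ℱ.le s)).measurable
  have hmx' : ∀ s, Measurable (x' s) := fun s => ((hx'.adapted s).mono (ℱ.le s)).measurable
  refine tendstoInMeasure_of_subseq (fun m => Measurable.aestronglyMeasurable (by fun_prop))
    (forall_fin_five_tendstoInMeasure ha hb hp hq hpq) ?_
  filter_upwards [hψc] with ω hω ns hns hall
  obtain ⟨C, hC⟩ := (isCompact_Icc (a := (0 : ℝ≥0)) (b := t)).exists_bound_of_continuousOn
    hω.continuousOn
  have hp' := hall 2
  have hq' := hall 3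
  simp only [one_mul, ← sq] at hp' hq'
  exact tendsto_sum_mul_mul_of_close (N := fun i => N (ns i)) (C := C)
    (ψ := fun i k => ψ (τ (ns i) k) ω)
    (fun i k hk => hC _ ⟨zero_le, (hτ.subdivision (ns i)).le_last hk.le⟩)
    (hall 0) (hall 1) hp' hq' (hall 4)

/-- Itô's product rule for two processes whose product has no martingale part. -/
lemma IsItoProcess.mul_eq (hW : IsBrownian ℱ μ W) (hx : IsItoProcess ℱ μ W G g c x)
    (hx' : IsItoProcess ℱ μ W G' g' c' x')
    (hcancel : ∀ j s ω, x s ω * G' j s ω + x' s ω * G j s ω = 0) :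
    ∀ᵐ ω ∂μ, ∀ t : ℝ≥0, x t ω * x' t ω = x 0 ω * x' 0 ω
      + ∫ s in (0 : ℝ)..t, (x s.toNNReal ω * g' s.toNNReal ω + x' s.toNNReal ω * g s.toNNReal ω
        + ∑ j, G j s.toNNReal ω * G' j s.toNNReal ω) := by
  have hcont : ∀ᵐ ω ∂μ, Continuous fun s : ℝ≥0 => x s ω * g' s ω + x' s ω * g s ω
      + ∑ j, G j s ω * G' j s ω := by
    filter_upwards [hx.continuous, hx'.continuous, hx.drift_continuous, hx'.drift_continuous,
      ae_all_iff.2 hx.isItoIntegral.integrand_continuous,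
      ae_all_iff.2 hx'.isItoIntegral.integrand_continuous] with ω h1 h2 h3 h4 h5 h6
    fun_prop
  refine ae_forall_eq_of_continuous ?_ ?_ fun t => ?_
  · filter_upwards [hx.continuous, hx'.continuous] with ω h1 h2
    exact h1.mul h2
  · filter_upwards [hcont] with ω h
    have h' : Continuous fun s : ℝ => x s.toNNReal ω * g' s.toNNReal ω
        + x' s.toNNReal ω * g s.toNNReal ω + ∑ j, G j s.toNNReal ω * G' j s.toNNReal ω :=
      h.comp continuous_real_toNNReal
    exact continuous_const.add ((intervalIntegral.continuous_primitive
      (fun a b => h'.intervalIntegrable a b) 0).comp NNReal.continuous_coe)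
  · have hτ := isRefining_equidist t
    have h1 := hx'.tendsto_sum_mul hW hx.adapted hx.continuous hτ
    have h2 := hx.tendsto_sum_mul hW hx'.adapted hx'.continuous hτ
    have h3 := hx.tendsto_sum_mul_mul hW hx' (ψ := fun _ _ => 1)
      (fun s => stronglyMeasurable_const) (Eventually.of_forall fun ω => continuous_const) hτ
    obtain ⟨ns, hns, hall⟩ := exists_subseq_forall_tendsto_ae
      (forall_fin_three_tendstoInMeasure h1 h2 h3)
    filter_upwards [hall, hx.continuous, hx'.continuous, hx.drift_continuous,
      hx'.drift_continuous, ae_all_iff.2 hx.isItoIntegral.integrand_continuous,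
      ae_all_iff.2 hx'.isItoIntegral.integrand_continuous] with ω hω hc1 hc2 hc3 hc4 hc5 hc6
    have hω0 := hω 0
    have hω1 := hω 1
    have hω2 := hω 2
    simp only [Matrix.cons_val_zero, Matrix.cons_val_one, Matrix.cons_val] at hω0 hω1 hω2
    have hlim := (hω0.add hω1).add hω2
    have hconst : ∀ i : ℕ, x t ω * x' t ω - x 0 ω * x' 0 ω
        = ∑ k ∈ Finset.range (ns i + 1), (x (equidist 0 t (ns i + 1) (k + 1)) ω
            * x' (equidist 0 t (ns i + 1) (k + 1)) ω
          - x (equidist 0 t (ns i + 1) k) ω * x' (equidist 0 t (ns i + 1) k) ω) := fun i => by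
      have hs := (hτ.subdivision (ns i))
      have := Finset.sum_range_sub (fun k => x (equidist 0 t (ns i + 1) k) ω
        * x' (equidist 0 t (ns i + 1) k) ω) (ns i + 1)
      rw [hs.first, hs.last] at this
      exact this.symm
    have huniq := tendsto_nhds_unique (hlim.congr fun i => ?_)
      (tendsto_const_nhds (x := x t ω * x' t ω - x 0 ω * x' 0 ω))
    · rw [← sub_eq_iff_eq_add', ← huniq]
      have hr := continuous_real_toNNReal
      have e1 : Continuous fun s : ℝ => x s.toNNReal ω * g' s.toNNReal ω :=
        (hc1.mul hc4).comp hr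
      have e2 : Continuous fun s : ℝ => x' s.toNNReal ω * g s.toNNReal ω :=
        (hc2.mul hc3).comp hr
      have e3 : Continuous fun s : ℝ => ∑ j, G j s.toNNReal ω * G' j s.toNNReal ω :=
        (show Continuous fun s : ℝ≥0 => ∑ j, G j s ω * G' j s ω by fun_prop).comp hr
      have e12 : Continuous fun s : ℝ => x s.toNNReal ω * g' s.toNNReal ω
          + x' s.toNNReal ω * g s.toNNReal ω := e1.add e2
      rw [intervalIntegral.integral_add (e12.intervalIntegrable _ _)
        (e3.intervalIntegrable _ _), intervalIntegral.integral_add (e1.intervalIntegrable _ _)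
        (e2.intervalIntegrable _ _)]
      simp
    · rw [hconst i]
      rw [← Finset.sum_add_distrib, ← Finset.sum_add_distrib]
      refine Finset.sum_congr rfl fun k _ => ?_
      set u := equidist 0 t (ns i + 1) k
      set v := equidist 0 t (ns i + 1) (k + 1)
      have hz : x u ω * (∑ j, G' j u ω * (W j v ω - W j u ω))
          + x' u ω * ∑ j, G j u ω * (W j v ω - W j u ω) = 0 := by
        rw [Finset.mul_sum, Finset.mul_sum, ← Finset.sum_add_distrib]
        refine Finset.sum_eq_zero fun j _ => ?_
        linear_combination (W j v ω - W j u ω) * hcancel j u ω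
      linear_combination (-1 : ℝ) * hz

/-- Itô's formula for the logarithm of a positive process `dx = x (H dW + h dt)`, solved for the
stochastic integral of `H`. -/
lemma IsItoProcess.tendsto_log (hW : IsBrownian ℱ μ W) {H : ι → ℝ≥0 → Ω → ℝ} {h : ℝ≥0 → Ω → ℝ}
    (hx : IsItoProcess ℱ μ W (fun j s ω => x s ω * H j s ω) (fun s ω => x s ω * h s ω) c x)
    (hpos : ∀ᵐ ω ∂μ, ∀ s, 0 < x s ω) (hH : ∀ j s, StronglyMeasurable[ℱ s] (H j s))
    (hτ : IsRefining t N τ) :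
    TendstoInMeasure μ (fun m ω => ∑ k ∈ Finset.range (N m), ∑ j,
      H j (τ m k) ω * (W j (τ m (k + 1)) ω - W j (τ m k) ω)) atTop
      (fun ω => Real.log (x t ω) - Real.log (x 0 ω) - (∫ s in (0 : ℝ)..t, h s.toNNReal ω)
        + 1 / 2 * ∫ s in (0 : ℝ)..t, ∑ j, H j s.toNNReal ω ^ 2) := by
  have hinv : ∀ᵐ ω ∂μ, Continuous fun s => (x s ω)⁻¹ := by
    filter_upwards [hpos, hx.continuous] with ω h1 h2
    exact h2.inv₀ fun s => (h1 s).ne'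
  have hinvm : ∀ s, StronglyMeasurable[ℱ s] (fun ω => (x s ω)⁻¹) := fun s =>
    (hx.adapted s).measurable.inv.stronglyMeasurable
  have h1 := hx.tendsto_sum_mul hW hinvm hinv hτ
  have h2 := hx.tendsto_sum_mul_mul hW hx (ψ := fun s ω => (x s ω)⁻¹ ^ 2)
    (fun s => (hinvm s).pow 2) (hinv.mono fun ω hω => hω.pow 2) hτ
  have hmH : ∀ j s, Measurable (H j s) := fun j s => ((hH j s).mono (ℱ.le s)).measurable
  have hmW : ∀ j s, Measurable (W j s) := fun j s => ((hW.adapted j s).mono (ℱ.le s)).measurable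
  refine tendstoInMeasure_of_subseq (fun m => Measurable.aestronglyMeasurable (by fun_prop))
    (forall_fin_two_tendstoInMeasure h1 h2) ?_
  filter_upwards [hpos, hx.continuous] with ω hp hc ns hns hall
  have hτ' := hτ.comp hns
  have hA := hall 0
  have hB := hall 1
  simp only [Matrix.cons_val_zero, Matrix.cons_val_one] at hA hB
  set y : ℕ → ℕ → ℝ := fun i k =>
    (x (τ (ns i) (k + 1)) ω - x (τ (ns i) k) ω) * (x (τ (ns i) k) ω)⁻¹ with hy
  have eA : ∫ s in (0 : ℝ)..t, (x s.toNNReal ω)⁻¹ * (x s.toNNReal ω * h s.toNNReal ω)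
      = ∫ s in (0 : ℝ)..t, h s.toNNReal ω :=
    intervalIntegral.integral_congr fun s _ => inv_mul_cancel_left₀ (hp _).ne' _
  have eB : ∫ s in (0 : ℝ)..t, (x s.toNNReal ω)⁻¹ ^ 2 *
        ∑ j, x s.toNNReal ω * H j s.toNNReal ω * (x s.toNNReal ω * H j s.toNNReal ω)
      = ∫ s in (0 : ℝ)..t, ∑ j, H j s.toNNReal ω ^ 2 :=
    intervalIntegral.integral_congr fun s _ => by
      simp only [Finset.mul_sum]
      refine Finset.sum_congr rfl fun j _ => ?_
      have := (hp s.toNNReal).ne'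
      field_simp
  rw [eA] at hA
  rw [eB] at hB
  have hB' : Tendsto (fun i => ∑ k ∈ Finset.range (N (ns i)), y i k ^ 2) atTop
      (𝓝 (∫ s in (0 : ℝ)..t, ∑ j, H j s.toNNReal ω ^ 2)) := by
    refine hB.congr fun i => Finset.sum_congr rfl fun k _ => ?_
    simp only [hy]; ring
  -- The relative increments `y = Δx / x` tend to `0` uniformly.
  have hsmall : ∀ ε > 0, ∀ᶠ i in atTop, ∀ k < N (ns i), |y i k| < ε := by
    intro ε hε
    obtain ⟨s₀, -, hs₀⟩ := (isCompact_Icc (a := (0 : ℝ≥0)) (b := t)).exists_isMinOn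
      ⟨0, le_rfl, zero_le⟩ hc.continuousOn
    filter_upwards [hτ'.eventually_forall_abs_sub_lt hc (mul_pos hε (hp s₀))] with i hi k hk
    have h1 := hi k hk _ ((hτ'.subdivision i).le k hk) le_rfl
    have h2 : x s₀ ω ≤ x (τ (ns i) k) ω :=
      hs₀ ⟨zero_le, (hτ'.subdivision i).le_last hk.le⟩
    simp only [hy]
    rw [abs_mul, abs_inv, abs_of_pos (hp _), ← div_eq_mul_inv, div_lt_iff₀ (hp _)]
    exact h1.trans_le (mul_le_mul_of_nonneg_left h2 hε.le)
  have hlog : ∀ i k, 1 + y i k = x (τ (ns i) (k + 1)) ω / x (τ (ns i) k) ω := fun i k => by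
    have := (hp (τ (ns i) k)).ne'
    simp only [hy]; field_simp; ring
  have hrem : Tendsto (fun i => ∑ k ∈ Finset.range (N (ns i)),
      (y i k - Real.log (1 + y i k) - 1 / 2 * y i k ^ 2)) atTop (𝓝 0) := by
    rw [Metric.tendsto_atTop']
    intro ε hε
    set Q := ∫ s in (0 : ℝ)..t, ∑ j, H j s.toNNReal ω ^ 2 with hQ
    have hQ0 : 0 ≤ Q := ge_of_tendsto' hB' fun i => Finset.sum_nonneg fun k _ => sq_nonneg _
    have hε' : 0 < min (1 / 2) (ε / (2 * (Q + 1))) := lt_min (by norm_num) (by positivity)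
    have hev := (hsmall _ hε').and (hB'.eventually (gt_mem_nhds (show Q < Q + 1 by linarith)))
    obtain ⟨i₀, hi₀⟩ := eventually_atTop.1 hev
    refine ⟨i₀, fun i hi => ?_⟩
    obtain ⟨hyi, hQi⟩ := hi₀ i hi.le
    rw [Real.dist_eq, sub_zero]
    refine (Finset.abs_sum_le_sum_abs _ _).trans_lt ?_
    calc _ ≤ ∑ k ∈ Finset.range (N (ns i)), ε / (Q + 1) * y i k ^ 2 := by
          refine Finset.sum_le_sum fun k hk => ?_
          have hyk := hyi k (Finset.mem_range.1 hk)
          have hy1 : |y i k| < 1 / 2 := hyk.trans_le (min_le_left _ _)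
          have hy2 : |y i k| < ε / (2 * (Q + 1)) := hyk.trans_le (min_le_right _ _)
          have hl := Real.abs_log_sub_add_sum_range_le (x := -y i k)
            (by rw [abs_neg]; linarith) 2
          rw [abs_neg, sub_neg_eq_add] at hl
          have e : y i k - Real.log (1 + y i k) - 1 / 2 * y i k ^ 2
              = -(∑ l ∈ Finset.range 2, (-y i k) ^ (l + 1) / ((l : ℝ) + 1)
                + Real.log (1 + y i k)) := by
            simp only [Finset.sum_range_succ, Finset.sum_range_zero]
            push_cast
            ring
          rw [e, abs_neg]
          refine hl.trans ?_
          rw [div_le_iff₀ (by linarith), pow_succ, sq_abs]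
          have h3 : |y i k| ≤ ε / (Q + 1) * (1 - |y i k|) := by
            have : ε / (2 * (Q + 1)) = ε / (Q + 1) * (1 / 2) := by field_simp
            rw [this] at hy2
            refine hy2.le.trans (mul_le_mul_of_nonneg_left (by linarith) (by positivity))
          calc y i k ^ 2 * |y i k| ≤ y i k ^ 2 * (ε / (Q + 1) * (1 - |y i k|)) :=
                mul_le_mul_of_nonneg_left h3 (sq_nonneg _)
            _ = _ := by ring
      _ < ε := by
          rw [← Finset.mul_sum, div_mul_eq_mul_div, div_lt_iff₀ (by positivity)]
          exact mul_lt_mul_of_pos_left hQi hε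
  have hfin := ((hrem.add (hB'.const_mul (1 / 2))).add_const
    (Real.log (x t ω) - Real.log (x 0 ω))).sub hA
  rw [zero_add, add_comm (1 / 2 * _), add_sub_right_comm] at hfin
  refine hfin.congr fun i => ?_
  have htel : Real.log (x t ω) - Real.log (x 0 ω)
      = ∑ k ∈ Finset.range (N (ns i)), Real.log (1 + y i k) := by
    have := Finset.sum_range_sub (fun k => Real.log (x (τ (ns i) k) ω)) (N (ns i))
    rw [(hτ.subdivision (ns i)).first, (hτ.subdivision (ns i)).last] at this
    rw [← this]
    refine Finset.sum_congr rfl fun k _ => ?_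
    rw [hlog, Real.log_div (hp _).ne' (hp _).ne']
  rw [htel, Finset.mul_sum, ← Finset.sum_add_distrib, ← Finset.sum_add_distrib,
    ← Finset.sum_sub_distrib]
  refine Finset.sum_congr rfl fun k _ => ?_
  have hsum : ∑ j, x (τ (ns i) k) ω * H j (τ (ns i) k) ω *
      (W j (τ (ns i) (k + 1)) ω - W j (τ (ns i) k) ω)
      = x (τ (ns i) k) ω * ∑ j, H j (τ (ns i) k) ω *
      (W j (τ (ns i) (k + 1)) ω - W j (τ (ns i) k) ω) := by
    rw [Finset.mul_sum]
    exact Finset.sum_congr rfl fun j _ => mul_assoc _ _ _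
  rw [hsum]
  have := (hp (τ (ns i) k)).ne'
  simp only [hy]
  field_simp
  ring

end ItoProcesses

/-! ### The hyperbolic entropy -/

section Entropy

/-- One coordinate of the hyperbolic entropy, as a function of `c = 2 a²`. -/
noncomputable def phiCoord (c x : ℝ) : ℝ := 1 / 4 * (x * Real.arsinh (x / c) - √(x ^ 2 + c ^ 2))

variable {c m R x : ℝ}

lemma mul_sqrt_one_add_div_sq (hc : 0 < c) (x : ℝ) : c * √(1 + (x / c) ^ 2) = √(x ^ 2 + c ^ 2) := by
  rw [show x ^ 2 + c ^ 2 = c ^ 2 * (1 + (x / c) ^ 2) by field_simp; ring,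
    Real.sqrt_mul (sq_nonneg c), Real.sqrt_sq hc.le]

lemma hasDerivAt_arsinh_div (c x : ℝ) :
    HasDerivAt (fun y => Real.arsinh (y / c)) ((√(1 + (x / c) ^ 2))⁻¹ * (1 / c)) x := by
  simpa using ((hasDerivAt_id x).div_const c).arsinh

lemma hasDerivAt_phiCoord (hc : 0 < c) (x : ℝ) :
    HasDerivAt (phiCoord c) (1 / 4 * Real.arsinh (x / c)) x := by
  have hpos : 0 < x ^ 2 + c ^ 2 := by positivity
  have h1 := (hasDerivAt_id x).mul (hasDerivAt_arsinh_div c x)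
  have h2 := (((hasDerivAt_id x).fun_pow 2).add_const (c ^ 2)).sqrt hpos.ne'
  have h := (h1.sub h2).const_mul (1 / 4)
  refine h.congr_deriv ?_
  have hs : √(x ^ 2 + c ^ 2) ≠ 0 := (Real.sqrt_pos.2 hpos).ne'
  have hs' : √(1 + (x / c) ^ 2) = √(x ^ 2 + c ^ 2) / c := by
    rw [← mul_sqrt_one_add_div_sq hc x]; field_simp
  simp only [id, hs']
  field_simp
  simp
  ring

/-- The second derivative of `phiCoord c` at `x` is `1 / (4 √(x² + c²))`. -/
lemma convexOn_phiCoord_sub (hc : 0 < c) (hm : m ≤ 1 / 4 * (1 / √(R ^ 2 + c ^ 2))) :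
    ConvexOn ℝ (Set.Icc (-R) R) (fun x => phiCoord c x - m / 2 * x ^ 2) := by
  have hd : ∀ x, HasDerivAt (fun x => phiCoord c x - m / 2 * x ^ 2)
      (1 / 4 * Real.arsinh (x / c) - m * x) x := fun x => by
    refine ((hasDerivAt_phiCoord hc x).sub (((hasDerivAt_id x).fun_pow 2).const_mul
      (m / 2))).congr_deriv ?_
    simp only [id]; ring
  have hd' : ∀ x, HasDerivAt (fun x => 1 / 4 * Real.arsinh (x / c) - m * x)
      (1 / 4 * ((√(1 + (x / c) ^ 2))⁻¹ * (1 / c)) - m) x := fun x => by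
    refine (((hasDerivAt_arsinh_div c x).const_mul (1 / 4)).sub
      ((hasDerivAt_id x).const_mul m)).congr_deriv ?_
    ring
  refine MonotoneOn.convexOn_of_deriv (convex_Icc _ _)
    (fun x _ => (hd x).continuousAt.continuousWithinAt)
    (fun x _ => (hd x).differentiableAt.differentiableWithinAt) ?_
  rw [show deriv (fun x => phiCoord c x - m / 2 * x ^ 2)
    = fun x => 1 / 4 * Real.arsinh (x / c) - m * x from funext fun x => (hd x).deriv]
  refine MonotoneOn.mono (monotoneOn_of_deriv_nonneg (convex_Icc (-R) R)
    (fun x _ => (hd' x).continuousAt.continuousWithinAt)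
    (fun x _ => (hd' x).differentiableAt.differentiableWithinAt) fun x hx => ?_) interior_subset
  rw [(hd' x).deriv]
  have hx' := interior_subset hx
  have hsq : x ^ 2 ≤ R ^ 2 := sq_le_sq' hx'.1 hx'.2
  have h1 : (√(1 + (x / c) ^ 2))⁻¹ * (1 / c) = 1 / √(x ^ 2 + c ^ 2) := by
    rw [← mul_sqrt_one_add_div_sq hc x]
    have : √(1 + (x / c) ^ 2) ≠ 0 := (Real.sqrt_pos.2 (by positivity)).ne'
    field_simp
  rw [h1]
  have h2 : 1 / √(R ^ 2 + c ^ 2) ≤ 1 / √(x ^ 2 + c ^ 2) :=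
    one_div_le_one_div_of_le (Real.sqrt_pos.2 (by positivity))
      (Real.sqrt_le_sqrt (by linarith))
  linarith

lemma phiCoord_neg (c x : ℝ) : phiCoord c (-x) = phiCoord c x := by
  simp [phiCoord, neg_div, Real.arsinh_neg]

lemma convexOn_phiCoord (hc : 0 < c) : ConvexOn ℝ Set.univ (phiCoord c) := by
  refine Monotone.convexOn_univ_of_deriv
    (fun x => (hasDerivAt_phiCoord hc x).differentiableAt) ?_
  rw [show deriv (phiCoord c) = fun x => 1 / 4 * Real.arsinh (x / c) from
    funext fun x => (hasDerivAt_phiCoord hc x).deriv]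
  intro x y hxy
  have : Real.arsinh (x / c) ≤ Real.arsinh (y / c) :=
    Real.arsinh_le_arsinh.2 (div_le_div_of_nonneg_right hxy hc.le)
  simp only
  linarith

/-- The tangent line of slope `1` shows that the entropy grows at least like `|x|`. -/
lemma exists_abs_sub_le_phiCoord (hc : 0 < c) : ∃ C, ∀ x, |x| - C ≤ phiCoord c x := by
  -- The derivative `arcsinh (x / c) / 4` takes the value `1` at `c sinh 4`.
  set x₀ := c * Real.sinh 4 with hx₀
  have hd : HasDerivAt (phiCoord c) 1 x₀ := by
    refine (hasDerivAt_phiCoord hc x₀).congr_deriv ?_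
    rw [hx₀, mul_div_cancel_left₀ _ hc.ne', Real.arsinh_sinh]
    norm_num
  have htan : ∀ x, phiCoord c x₀ + (x - x₀) ≤ phiCoord c x := fun x => by
    have hconv := convexOn_phiCoord hc
    rcases lt_trichotomy x₀ x with h | h | h
    · have := hconv.le_slope_of_hasDerivAt (Set.mem_univ _) (Set.mem_univ _) h hd
      rw [slope_def_field, le_div_iff₀ (by linarith)] at this
      linarith
    · simp [h]
    · have := hconv.slope_le_of_hasDerivAt (Set.mem_univ _) (Set.mem_univ _) h hd
      rw [slope_def_field, div_le_iff₀ (by linarith)] at this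
      linarith
  refine ⟨x₀ - phiCoord c x₀, fun x => ?_⟩
  rcases abs_cases x with ⟨h, _⟩ | ⟨h, _⟩
  · rw [h]; linarith [htan x]
  · rw [h, ← phiCoord_neg c x]; linarith [htan (-x)]

variable {d : ℕ} {a : Fin d → ℝ}

lemma phi_eq_sum (a : Fin d → ℝ) (b : EuclideanSpace ℝ (Fin d)) :
    phi a b = ∑ i, phiCoord (2 * a i ^ 2) (b i) := by
  rw [phi, Finset.mul_sum]
  refine Finset.sum_congr rfl fun i _ => ?_
  rw [phiCoord, show (2 * a i ^ 2) ^ 2 = 4 * a i ^ 4 by ring]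

/-- The gradient of the hyperbolic entropy `φ_a`. -/
noncomputable def gradPhi (a : Fin d → ℝ) (b : EuclideanSpace ℝ (Fin d)) :
    EuclideanSpace ℝ (Fin d) :=
  WithLp.toLp 2 fun i => 1 / 4 * Real.arsinh (b i / (2 * a i ^ 2))

lemma hasDerivAt_phi_add_smul (ha : ∀ i, 0 < a i) (b v : EuclideanSpace ℝ (Fin d)) :
    HasDerivAt (fun s : ℝ => phi a (b + s • v)) (inner ℝ (gradPhi a b) v) 0 := by
  have h : ∀ i ∈ Finset.univ, HasDerivAt (fun s : ℝ => phiCoord (2 * a i ^ 2) ((b + s • v) i))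
      (v i * (1 / 4 * Real.arsinh (b i / (2 * a i ^ 2)))) 0 := fun i _ => by
    have hlin : HasDerivAt (fun s : ℝ => b i + s * v i) (v i) 0 := by
      simpa using ((hasDerivAt_id (0 : ℝ)).mul_const (v i)).const_add (b i)
    have hc : 0 < 2 * a i ^ 2 := by have := ha i; positivity
    have := (hasDerivAt_phiCoord hc (b i + 0 * v i)).comp 0 hlin
    simp only [zero_mul, add_zero] at this
    refine (this.congr_deriv (mul_comm _ _)).congr_of_eventuallyEq
      (Eventually.of_forall fun s => ?_)
    simp
  have hs := HasDerivAt.fun_sum h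
  simp only [← phi_eq_sum] at hs
  refine hs.congr_deriv ?_
  simp [PiLp.inner_apply, gradPhi]

lemma continuous_phi (ha : ∀ i, 0 < a i) : Continuous (phi a) := by
  have : ∀ i, Continuous (phiCoord (2 * a i ^ 2)) := fun i => by
    have hc : 0 < 2 * a i ^ 2 := by have := ha i; positivity
    exact continuous_iff_continuousAt.2 fun x => (hasDerivAt_phiCoord hc x).continuousAt
  rw [show phi a = fun b => ∑ i, phiCoord (2 * a i ^ 2) (b i) from funext (phi_eq_sum a)]
  exact continuous_finsetSum _ fun i _ => (this i).comp (by fun_prop)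

lemma exists_strongConvexOn_phi (ha : ∀ i, 0 < a i) {S : Set (EuclideanSpace ℝ (Fin d))}
    (hS : Bornology.IsBounded S) (hconv : Convex ℝ S) :
    ∃ m > 0, StrongConvexOn S m (phi a) := by
  obtain ⟨R, hR⟩ := hS.exists_norm_le
  have hc : ∀ i, 0 < 2 * a i ^ 2 := fun i => by have := ha i; positivity
  obtain ⟨m, hm, hmi⟩ : ∃ m > 0, ∀ i, m ≤ 1 / 4 * (1 / √(R ^ 2 + (2 * a i ^ 2) ^ 2)) := by
    rcases isEmpty_or_nonempty (Fin d) with h | h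
    · exact ⟨1, one_pos, fun i => h.elim i⟩
    · obtain ⟨i₀, hi₀⟩ := Finite.exists_min
        (fun i => 1 / 4 * (1 / √(R ^ 2 + (2 * a i ^ 2) ^ 2)))
      refine ⟨_, ?_, hi₀⟩
      have := hc i₀
      have : 0 < √(R ^ 2 + (2 * a i₀ ^ 2) ^ 2) := Real.sqrt_pos.2 (by positivity)
      positivity
  refine ⟨m, hm, strongConvexOn_iff_convex.2 ⟨hconv, fun x hx y hy p q hp hq hpq => ?_⟩⟩
  have key : ∀ b : EuclideanSpace ℝ (Fin d), phi a b - m / 2 * ‖b‖ ^ 2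
      = ∑ i, (phiCoord (2 * a i ^ 2) (b i) - m / 2 * b i ^ 2) := fun b => by
    rw [phi_eq_sum, EuclideanSpace.real_norm_sq_eq, Finset.mul_sum, Finset.sum_sub_distrib]
  have hmem : ∀ b ∈ S, ∀ i, b i ∈ Set.Icc (-R) R := fun b hb i => by
    rw [Set.mem_Icc, ← abs_le, ← Real.norm_eq_abs]
    exact (PiLp.norm_apply_le b i).trans (hR b hb)
  simp only [key, smul_eq_mul, Finset.mul_sum, ← Finset.sum_add_distrib]
  refine Finset.sum_le_sum fun i _ => ?_
  simpa using (convexOn_phiCoord_sub (hc i) (hmi i)).2 (hmem x hx i) (hmem y hy i) hp hq hpq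

lemma tendsto_phi_cocompact (ha : ∀ i, 0 < a i) :
    Tendsto (phi a) (cocompact (EuclideanSpace ℝ (Fin d))) atTop := by
  have hc : ∀ i, 0 < 2 * a i ^ 2 := fun i => by have := ha i; positivity
  choose C hC using fun i => exists_abs_sub_le_phiCoord (hc i)
  refine tendsto_atTop_mono (fun b => ?_)
    (tendsto_atTop_add_const_right _ (-∑ i, C i) (tendsto_norm_cocompact_atTop))
  have h1 : ‖b‖ ≤ ∑ i, |b i| := by
    refine abs_le_of_sq_le_sq' ?_ (Finset.sum_nonneg fun i _ => abs_nonneg _) |>.2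
    rw [EuclideanSpace.real_norm_sq_eq]
    simpa using Finset.sum_sq_le_sq_sum_of_nonneg (s := Finset.univ) (f := fun i => |b i|)
      (fun i _ => abs_nonneg _)
  have h2 : ∑ i, (|b i| - C i) ≤ phi a b := by
    rw [phi_eq_sum]
    exact Finset.sum_le_sum fun i _ => hC i (b i)
  rw [Finset.sum_sub_distrib] at h2
  linarith

end Entropy

/-! ### Entropy minimisation over the interpolators -/

section Minimisation

variable {n d : ℕ} {a : Fin d → ℝ} {X : Matrix (Fin n) (Fin d) ℝ} {Y : Fin n → ℝ}

lemma isClosed_interpolators (X : Matrix (Fin n) (Fin d) ℝ) (Y : Fin n → ℝ) :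
    IsClosed (interpolators X Y) := by
  refine isClosed_eq ?_ continuous_const
  exact (Continuous.matrix_mulVec continuous_const (by fun_prop))

lemma convex_interpolators (X : Matrix (Fin n) (Fin d) ℝ) (Y : Fin n → ℝ) :
    Convex ℝ (interpolators X Y) := by
  intro x hx y hy p q _ _ hpq
  simp only [interpolators, Set.mem_ofPred_eq] at *
  rw [WithLp.ofLp_add, WithLp.ofLp_smul, WithLp.ofLp_smul, Matrix.mulVec_add, Matrix.mulVec_smul,
    Matrix.mulVec_smul, hx, hy, ← add_smul, hpq, one_smul]

lemma mulVec_sub_eq_zero {b b' : EuclideanSpace ℝ (Fin d)} (hb : b ∈ interpolators X Y)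
    (hb' : b' ∈ interpolators X Y) : X *ᵥ (b' - b).ofLp = 0 := by
  simp only [interpolators, Set.mem_ofPred_eq] at hb hb'
  rw [WithLp.ofLp_sub, Matrix.mulVec_sub, hb, hb', sub_self]

lemma exists_isConstrainedMin (ha : ∀ i, 0 < a i) {b₀ : EuclideanSpace ℝ (Fin d)}
    (h₀ : b₀ ∈ interpolators X Y) : ∃ b, IsConstrainedMin X Y (phi a) b := by
  obtain ⟨b, hb, hmin⟩ := (continuous_phi ha).continuousOn.exists_isMinOn'
    (isClosed_interpolators X Y) h₀
    (((tendsto_phi_cocompact ha).eventually_ge_atTop (phi a b₀)).filter_mono inf_le_left)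
  exact ⟨b, hb, hmin⟩

lemma IsConstrainedMin.eq (ha : ∀ i, 0 < a i) {b b' : EuclideanSpace ℝ (Fin d)}
    (hb : IsConstrainedMin X Y (phi a) b) (hb' : IsConstrainedMin X Y (phi a) b') : b' = b := by
  obtain ⟨m, hm, h⟩ := exists_strongConvexOn_phi ha (S := segment ℝ b b')
    (by
      rw [segment_eq_image_lineMap]
      exact (isCompact_Icc.image AffineMap.lineMap_continuous).isBounded) (convex_segment b b')
  have hsub : segment ℝ b b' ⊆ interpolators X Y :=
    (convex_interpolators X Y).segment_subset hb.1 hb'.1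
  exact (h.strictConvexOn hm).eq_of_isMinOn (hb'.2.on_subset hsub) (hb.2.on_subset hsub)
    (right_mem_segment ℝ b b') (left_mem_segment ℝ b b')

/-- The first-order form of strong convexity on `S`, from the restriction of `φ_a` to the segment
from `x` to `y`. -/
lemma add_inner_gradPhi_le (ha : ∀ i, 0 < a i) {S : Set (EuclideanSpace ℝ (Fin d))}
    {m : ℝ} (h : StrongConvexOn S m (phi a)) {x y : EuclideanSpace ℝ (Fin d)} (hx : x ∈ S)
    (hy : y ∈ S) :
    phi a x + inner ℝ (gradPhi a x) (y - x) + m / 2 * ‖y - x‖ ^ 2 ≤ phi a y := by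
  have hconv := strongConvexOn_iff_convex.1 h
  have hline : ConvexOn ℝ (Set.Icc (0 : ℝ) 1)
      (fun s => phi a (x + s • (y - x)) - m / 2 * ‖x + s • (y - x)‖ ^ 2) := by
    have hc := hconv.comp_affineMap (AffineMap.lineMap x y : ℝ →ᵃ[ℝ] EuclideanSpace ℝ (Fin d))
    refine (hc.subset (fun s hs => ?_) (convex_Icc _ _)).congr fun s _ => ?_
    · exact hconv.1.lineMap_mem hx hy hs
    · simp [AffineMap.lineMap_apply, add_comm]
  have hnorm : HasDerivAt (fun s : ℝ => m / 2 * ‖x + s • (y - x)‖ ^ 2)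
      (m * inner ℝ x (y - x)) 0 := by
    have he : (fun s : ℝ => m / 2 * ‖x + s • (y - x)‖ ^ 2) = fun s =>
        m / 2 * (‖x‖ ^ 2 + 2 * (s * inner ℝ x (y - x)) + s ^ 2 * ‖y - x‖ ^ 2) := by
      funext s
      rw [norm_add_sq_real, real_inner_smul_right, norm_smul, mul_pow, Real.norm_eq_abs, sq_abs]
    rw [he]
    have := ((((hasDerivAt_id (0 : ℝ)).mul_const (inner ℝ x (y - x))).const_mul 2).const_add
      (‖x‖ ^ 2)).add (((hasDerivAt_id (0 : ℝ)).fun_pow 2).mul_const (‖y - x‖ ^ 2))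
    refine (this.const_mul (m / 2)).congr_deriv ?_
    simp
    ring
  have hd := (hasDerivAt_phi_add_smul ha x (y - x)).sub hnorm
  have hslope := hline.le_slope_of_hasDerivAt (x := 0) (y := 1) (by simp) (by simp) one_pos hd
  rw [slope_def_field] at hslope
  simp only [one_smul, zero_smul, add_zero, sub_zero, div_one, add_sub_cancel] at hslope
  have hy2 : ‖y‖ ^ 2 = ‖x‖ ^ 2 + 2 * inner ℝ x (y - x) + ‖y - x‖ ^ 2 := by
    rw [← norm_add_sq_real, add_sub_cancel]
  rw [hy2] at hslope
  linarith

/-- At a minimiser over the interpolators the gradient is orthogonal to the kernel of `X`. -/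
lemma IsConstrainedMin.inner_gradPhi_eq_zero (ha : ∀ i, 0 < a i) {b v : EuclideanSpace ℝ (Fin d)}
    (hb : IsConstrainedMin X Y (phi a) b) (hv : X *ᵥ v.ofLp = 0) :
    inner ℝ (gradPhi a b) v = 0 := by
  refine IsLocalMin.hasDerivAt_eq_zero (Eventually.of_forall fun s => ?_)
    (hasDerivAt_phi_add_smul ha b v)
  simp only [zero_smul, add_zero]
  refine hb.2 ?_
  have := hb.1
  simp only [interpolators, Set.mem_ofPred_eq] at *
  rw [WithLp.ofLp_add, WithLp.ofLp_smul, Matrix.mulVec_add, Matrix.mulVec_smul, hv, smul_zero,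
    add_zero, this]

lemma sum_oneSubProj_mul (X : Matrix (Fin n) (Fin d) ℝ) (y : EuclideanSpace ℝ (Fin d))
    (i : Fin d) :
    ∑ j, oneSubProj X i j * y j = (y - (rowSpan X).starProjection y) i := by
  let L : EuclideanSpace ℝ (Fin d) →L[ℝ] EuclideanSpace ℝ (Fin d) :=
    ContinuousLinearMap.id ℝ _ - (rowSpan X).starProjection
  have hy : y = ∑ j, y j • EuclideanSpace.single j (1 : ℝ) := by
    have := (EuclideanSpace.basisFun (Fin d) ℝ).sum_repr y
    simpa using this.symm
  have hL : L y = ∑ j, y j • L (EuclideanSpace.single j 1) := by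
    conv_lhs => rw [hy]
    simp
  have : (y - (rowSpan X).starProjection y) = L y := rfl
  rw [this, hL]
  simp only [WithLp.ofLp_sum, Finset.sum_apply, PiLp.smul_apply, smul_eq_mul]
  refine Finset.sum_congr rfl fun j _ => ?_
  rw [mul_comm]
  rfl

lemma sum_oneSubProj_mul_eq_zero (X : Matrix (Fin n) (Fin d) ℝ) (i : Fin d)
    {y : EuclideanSpace ℝ (Fin d)} (hy : y ∈ rowSpan X) : ∑ j, oneSubProj X i j * y j = 0 := by
  rw [sum_oneSubProj_mul, Submodule.starProjection_eq_self_iff.2 hy, sub_self]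
  rfl

/-- The distance from an interpolator to the entropy minimiser is controlled by the part of the
gradient that is orthogonal to the row span. -/
lemma norm_sub_le_of_isConstrainedMin (ha : ∀ i, 0 < a i) {S : Set (EuclideanSpace ℝ (Fin d))}
    {m : ℝ} (hm : 0 < m) (h : StrongConvexOn S m (phi a)) {b b' r : EuclideanSpace ℝ (Fin d)}
    (hb : IsConstrainedMin X Y (phi a) b) (hb' : b' ∈ interpolators X Y) (hbS : b ∈ S)
    (hbS' : b' ∈ S) (hr : ∀ i, r i = ∑ j, oneSubProj X i j * gradPhi a b' j) :
    ‖b - b'‖ ≤ 1 / m * ‖r‖ := by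
  have hv : X *ᵥ (b - b').ofLp = 0 := mulVec_sub_eq_zero hb' hb.1
  have h1 := add_inner_gradPhi_le ha h hbS' hbS
  have h2 := add_inner_gradPhi_le ha h hbS hbS'
  rw [hb.inner_gradPhi_eq_zero ha (mulVec_sub_eq_zero hb.1 hb'), norm_sub_rev] at h2
  have hr' : r = gradPhi a b' - (rowSpan X).starProjection (gradPhi a b') := by
    ext i
    rw [hr, sum_oneSubProj_mul]
  have horth : inner ℝ ((rowSpan X).starProjection (gradPhi a b')) (b - b') = 0 := by
    have hmem : b - b' ∈ (rowSpan X)ᗮ := by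
      rw [rowSpan, Submodule.mem_orthogonal]
      intro u hu
      induction hu using Submodule.span_induction with
      | mem u hu =>
        obtain ⟨k, rfl⟩ := hu
        have := congrFun hv k
        simp only [Matrix.mulVec, dotProduct, Pi.zero_apply] at this
        simp only [PiLp.inner_apply, RCLike.inner_apply, conj_trivial]
        rw [← this]
        exact Finset.sum_congr rfl fun i _ => mul_comm _ _
      | zero => simp
      | add u w _ _ hu hw => rw [inner_add_left, hu, hw, add_zero]
      | smul p u _ hu => rw [real_inner_smul_left, hu, mul_zero]
    exact (rowSpan X).inner_right_of_mem_orthogonal (Submodule.starProjection_apply_mem _ _) hmem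
  have hinner : inner ℝ (gradPhi a b') (b - b') = inner ℝ r (b - b') := by
    rw [hr', inner_sub_left, horth, sub_zero]
  have hcs := abs_le.1 (abs_real_inner_le_norm r (b - b'))
  rw [hinner] at h1
  have hfin : m * ‖b - b'‖ ^ 2 ≤ ‖r‖ * ‖b - b'‖ := by linarith [hcs.1]
  rcases (norm_nonneg (b - b')).eq_or_lt with h0 | h0
  · rw [← h0]; positivity
  · rw [one_div, inv_mul_eq_div, le_div_iff₀ hm]
    nlinarith

end Minimisation

/-! ### Closed form of the flow -/

section Flow

/-- The linear differential equation `u' = -q u`, in integral form. -/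
lemma eq_mul_exp_of_integral_eq {u q : ℝ≥0 → ℝ} {c : ℝ} (hu : Continuous u) (hq : Continuous q)
    (h : ∀ t : ℝ≥0, u t = c - ∫ s in (0 : ℝ)..t, q s.toNNReal * u s.toNNReal) (t : ℝ≥0) :
    u t = c * Real.exp (-∫ s in (0 : ℝ)..t, q s.toNNReal) := by
  have hq' : Continuous fun s : ℝ => q s.toNNReal := hq.comp continuous_real_toNNReal
  have hqu : Continuous fun s : ℝ => q s.toNNReal * u s.toNNReal :=
    hq'.mul (hu.comp continuous_real_toNNReal)
  have hdq : ∀ s, HasDerivAt (fun r : ℝ => ∫ s in (0 : ℝ)..r, q s.toNNReal) (q s.toNNReal) s :=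
    fun s => intervalIntegral.integral_hasDerivAt_right (hq'.intervalIntegrable 0 s)
      hq'.aestronglyMeasurable.stronglyMeasurableAtFilter hq'.continuousAt
  have hdu : ∀ s, HasDerivAt (fun r : ℝ => c - ∫ s in (0 : ℝ)..r, q s.toNNReal * u s.toNNReal)
      (-(q s.toNNReal * u s.toNNReal)) s := fun s =>
    (intervalIntegral.integral_hasDerivAt_right (hqu.intervalIntegrable 0 s)
      hqu.aestronglyMeasurable.stronglyMeasurableAtFilter hqu.continuousAt).const_sub c
  have hd := fun s => (hdu s).mul (hdq s).exp
  have hzero : ∀ s ∈ Set.Ico (0 : ℝ) t, derivWithin ((fun r : ℝ => c - ∫ s in (0 : ℝ)..r,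
      q s.toNNReal * u s.toNNReal) * fun r => Real.exp (∫ s in (0 : ℝ)..r, q s.toNNReal))
      (Set.Icc 0 t) s = 0 := fun s hs => by
    rw [(hd s).hasDerivWithinAt.derivWithin
      (uniqueDiffOn_Icc (hs.1.trans_lt hs.2) s (Set.Ico_subset_Icc_self hs))]
    have := h s.toNNReal
    rw [Real.coe_toNNReal s hs.1] at this
    rw [← this]
    ring
  have hconst := constant_of_derivWithin_zero
    (fun s _ => (hd s).differentiableAt.differentiableWithinAt) hzero t
    (Set.right_mem_Icc.2 t.coe_nonneg)
  simp only [Pi.mul_apply, intervalIntegral.integral_same, sub_zero, Real.exp_zero, mul_one]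
    at hconst
  rw [← h t] at hconst
  rw [← hconst, mul_assoc, ← Real.exp_add, add_neg_cancel, Real.exp_zero, mul_one]

/-- With `x = w_{t,+}` and `y = w_{t,-}` this expresses `arcsinh (β_t / (2 α_t²))`, as
`α_t² = w_{t,+} w_{t,-}`. -/
lemma arsinh_eq_log_sub_log {x y : ℝ} (hx : 0 < x) (hy : 0 < y) :
    Real.arsinh ((x ^ 2 - y ^ 2) / (2 * (x * y))) = Real.log x - Real.log y := by
  rw [← Real.log_div hx.ne' hy.ne', ← Real.arsinh_sinh (Real.log (x / y)),
    Real.sinh_log (div_pos hx hy)]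
  congr 1
  field_simp

lemma continuous_loss {n d : ℕ} (κ : ℝ) (X : Matrix (Fin n) (Fin d) ℝ) (Y : Fin n → ℝ) :
    Continuous (loss κ X Y) := by
  have h : Continuous fun b : EuclideanSpace ℝ (Fin d) => X *ᵥ b.ofLp :=
    Continuous.matrix_mulVec continuous_const (by fun_prop)
  unfold loss
  fun_prop

lemma continuous_residual {n d : ℕ} (X : Matrix (Fin n) (Fin d) ℝ) (Y : Fin n → ℝ) :
    Continuous (residual X Y) := by
  have h : Continuous fun b : EuclideanSpace ℝ (Fin d) => X *ᵥ b.ofLp :=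
    Continuous.matrix_mulVec continuous_const (by fun_prop)
  unfold residual
  fun_prop

lemma loss_nonneg {n d : ℕ} {κ : ℝ} (hκ : 0 < κ) (X : Matrix (Fin n) (Fin d) ℝ) (Y : Fin n → ℝ)
    (b : EuclideanSpace ℝ (Fin d)) : 0 ≤ loss κ X Y b :=
  mul_nonneg hκ.le (Finset.sum_nonneg fun _ _ => sq_nonneg _)

variable {n d : ℕ} {Ω : Type*} {κ γ σ : ℝ} {α : Fin d → ℝ} {X : Matrix (Fin n) (Fin d) ℝ}
  {Y : Fin n → ℝ} {B : Fin n → ℝ≥0 → Ω → ℝ} {Bt : Fin d → ℝ≥0 → Ω → ℝ}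
  {wp wm : ℝ≥0 → Ω → EuclideanSpace ℝ (Fin d)}

/-- The relative noise of the flow: the `i`-th coordinate of
`2 √(γ L(β_t)) (X / √n)ᵀ dB_t + 2 σ √(γ L(β_t)) dB̃_t` as an integrand against `(B, B̃)`. -/
noncomputable def relNoise (κ γ σ : ℝ) (X : Matrix (Fin n) (Fin d) ℝ) (Y : Fin n → ℝ)
    (wp wm : ℝ≥0 → Ω → EuclideanSpace ℝ (Fin d)) (i : Fin d) : Fin n ⊕ Fin d → ℝ≥0 → Ω → ℝ
  | Sum.inl k, t, ω => 2 * √(γ * loss κ X Y (beta wp wm t ω)) * normX X k i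
  | Sum.inr j, t, ω => 2 * σ * √(γ * loss κ X Y (beta wp wm t ω)) * (if j = i then 1 else 0)

lemma noise_eq (v : ℝ≥0 → Ω → EuclideanSpace ℝ (Fin d)) (i : Fin d) :
    noise κ γ σ X Y wp wm v i = fun j t ω => v t ω i * relNoise κ γ σ X Y wp wm i j t ω := by
  funext j t ω
  cases j <;> simp only [noise, relNoise] <;> ring

/-- The squared relative noise is `4 γ L (diag(XᵀX / n) + σ²)`. -/
lemma sum_relNoise_sq (hκ : 0 < κ) (hγ : 0 < γ) (i : Fin d) (t : ℝ≥0) (ω : Ω) :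
    ∑ j, relNoise κ γ σ X Y wp wm i j t ω ^ 2
      = 4 * γ * (((normX X)ᵀ * normX X) i i + σ ^ 2) * loss κ X Y (beta wp wm t ω) := by
  have hs := Real.sq_sqrt (mul_nonneg hγ.le (loss_nonneg hκ X Y (beta wp wm t ω)))
  rw [Fintype.sum_sum_type]
  simp only [relNoise, mul_pow, hs, ← Finset.mul_sum, Matrix.mul_apply, Matrix.transpose_apply,
    ite_pow, one_pow, zero_pow two_ne_zero, Finset.sum_ite_eq', Finset.mem_univ, if_true, ← sq]
  ring

/-- The effective initialisation at time `t`,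
`α ∘ exp (-2 γ σ² ∫_0^t L(β_s) ds) ∘ exp (-2 γ diag(XᵀX / n) ∫_0^t L(β_s) ds)`. -/
noncomputable def alphaAt (κ γ σ : ℝ) (α : Fin d → ℝ) (X : Matrix (Fin n) (Fin d) ℝ)
    (Y : Fin n → ℝ) (wp wm : ℝ≥0 → Ω → EuclideanSpace ℝ (Fin d)) (t : ℝ≥0) (ω : Ω) (i : Fin d) :
    ℝ :=
  α i * Real.exp (-2 * γ * σ ^ 2 * ∫ s in (0 : ℝ)..t, loss κ X Y (beta wp wm s.toNNReal ω))
    * Real.exp (-2 * γ * ((normX X)ᵀ * normX X) i i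
        * ∫ s in (0 : ℝ)..t, loss κ X Y (beta wp wm s.toNNReal ω))

lemma alphaAt_sq (i : Fin d) (t : ℝ≥0) (ω : Ω) :
    alphaAt κ γ σ α X Y wp wm t ω i ^ 2 = α i * α i * Real.exp (-(4 * γ *
      (((normX X)ᵀ * normX X) i i + σ ^ 2)
        * ∫ s in (0 : ℝ)..t, loss κ X Y (beta wp wm s.toNNReal ω))) := by
  rw [alphaAt, mul_pow, mul_pow, ← Real.exp_nat_mul, ← Real.exp_nat_mul, mul_assoc, ← Real.exp_add,
    sq]
  congr 2
  push_cast
  ring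

lemma alphaAt_pos (hα : ∀ i, 0 < α i) (t : ℝ≥0) (ω : Ω) (i : Fin d) :
    0 < alphaAt κ γ σ α X Y wp wm t ω i :=
  mul_pos (mul_pos (hα i) (Real.exp_pos _)) (Real.exp_pos _)

lemma alphaInf_pos (hα : ∀ i, 0 < α i) (ω : Ω) (i : Fin d) :
    0 < alphaInf κ γ σ α X Y wp wm ω i :=
  mul_pos (mul_pos (hα i) (Real.exp_pos _)) (Real.exp_pos _)

section Paths

variable {ω : Ω}

lemma continuous_beta (hp : Continuous fun t => wp t ω) (hm : Continuous fun t => wm t ω) :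
    Continuous fun t => beta wp wm t ω := by
  unfold beta
  fun_prop

lemma continuous_drift (hβ : Continuous fun t => beta wp wm t ω) (i : Fin d) :
    Continuous fun t => drift X Y wp wm i t ω := by
  have h : Continuous fun t => (normX X)ᵀ *ᵥ residual X Y (beta wp wm t ω) :=
    Continuous.matrix_mulVec continuous_const ((continuous_residual X Y).comp hβ)
  exact (continuous_apply i).comp h

lemma continuous_alphaAt (hβ : Continuous fun t => beta wp wm t ω) (i : Fin d) :
    Continuous fun t => alphaAt κ γ σ α X Y wp wm t ω i := by
  have hl : Continuous fun s : ℝ => loss κ X Y (beta wp wm s.toNNReal ω) :=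
    ((continuous_loss κ X Y).comp hβ).comp continuous_real_toNNReal
  have hA : Continuous fun t : ℝ≥0 =>
      ∫ s in (0 : ℝ)..t, loss κ X Y (beta wp wm s.toNNReal ω) :=
    (intervalIntegral.continuous_primitive (fun a b => hl.intervalIntegrable a b) 0).comp
      NNReal.continuous_coe
  unfold alphaAt
  fun_prop

lemma ConvergesTo.tendsto_alphaAt {b : EuclideanSpace ℝ (Fin d)}
    (h : ConvergesTo κ X Y wp wm ω b) (i : Fin d) :
    Tendsto (fun t => alphaAt κ γ σ α X Y wp wm t ω i) atTop
      (𝓝 (alphaInf κ γ σ α X Y wp wm ω i)) := by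
  have hA : Tendsto (fun t : ℝ≥0 => ∫ s in (0 : ℝ)..t, loss κ X Y (beta wp wm s.toNNReal ω)) atTop
      (𝓝 (∫ s in Set.Ioi (0 : ℝ), loss κ X Y (beta wp wm s.toNNReal ω))) :=
    intervalIntegral_tendsto_integral_Ioi 0 h.integrable_loss
      (NNReal.tendsto_coe_atTop.2 tendsto_id)
  exact ((hA.const_mul _).rexp.const_mul _).mul (hA.const_mul _).rexp

end Paths

/-- The pathwise expression `(1 - P) ∇φ_{α_t}(β_t)` of the perturbation process. -/
noncomputable def perturbation (κ γ σ : ℝ) (α : Fin d → ℝ) (X : Matrix (Fin n) (Fin d) ℝ)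
    (Y : Fin n → ℝ) (wp wm : ℝ≥0 → Ω → EuclideanSpace ℝ (Fin d)) (t : ℝ≥0) (ω : Ω) :
    EuclideanSpace ℝ (Fin d) :=
  WithLp.toLp 2 fun i => ∑ j, oneSubProj X i j *
    gradPhi (alphaAt κ γ σ α X Y wp wm t ω) (beta wp wm t ω) j

lemma continuous_perturbation (hα : ∀ i, 0 < α i) {ω : Ω}
    (hβ : Continuous fun t => beta wp wm t ω) :
    Continuous fun t => perturbation κ γ σ α X Y wp wm t ω := by
  have ha := fun i => continuous_alphaAt (κ := κ) (γ := γ) (σ := σ) (α := α) (X := X) (Y := Y) hβ i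
  have hg : ∀ j, Continuous fun t =>
      gradPhi (alphaAt κ γ σ α X Y wp wm t ω) (beta wp wm t ω) j := fun j => by
    have hne : ∀ t, 2 * alphaAt κ γ σ α X Y wp wm t ω j ^ 2 ≠ 0 := fun t => by
      have := alphaAt_pos (κ := κ) (γ := γ) (σ := σ) (X := X) (Y := Y) (wp := wp) (wm := wm)
        hα t ω j
      positivity
    have hb : Continuous fun t => beta wp wm t ω j := (PiLp.continuous_apply 2 _ j).comp hβ
    exact continuous_const.mul (Real.continuous_arsinh.comp
      (hb.div (continuous_const.mul ((ha j).pow 2)) hne))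
  exact (PiLp.continuous_toLp 2 fun _ : Fin d => ℝ).comp
    (continuous_pi fun i => continuous_finsetSum _ fun j _ => (hg j).const_mul _)

lemma ConvergesTo.tendsto_perturbation (hα : ∀ i, 0 < α i) {ω : Ω}
    {b : EuclideanSpace ℝ (Fin d)} (h : ConvergesTo κ X Y wp wm ω b) :
    Tendsto (fun t => perturbation κ γ σ α X Y wp wm t ω) atTop
      (𝓝 (WithLp.toLp 2 fun i => ∑ j, oneSubProj X i j *
        gradPhi (alphaInf κ γ σ α X Y wp wm ω) b j)) := by
  have hg : ∀ j, Tendsto (fun t => gradPhi (alphaAt κ γ σ α X Y wp wm t ω) (beta wp wm t ω) j)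
      atTop (𝓝 (gradPhi (alphaInf κ γ σ α X Y wp wm ω) b j)) := fun j => by
    have hne : 2 * alphaInf κ γ σ α X Y wp wm ω j ^ 2 ≠ 0 := by
      have := alphaInf_pos (κ := κ) (γ := γ) (σ := σ) (X := X) (Y := Y) (wp := wp) (wm := wm)
        hα ω j
      positivity
    have hb : Tendsto (fun t => beta wp wm t ω j) atTop (𝓝 (b j)) :=
      ((PiLp.continuous_apply 2 _ j).tendsto b).comp h.tendsto
    exact ((Real.continuous_arsinh.tendsto _).comp
      (hb.div (((h.tendsto_alphaAt j).pow 2).const_mul 2) hne)).const_mul (1 / 4)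
  have hsum : ∀ i, Tendsto (fun t => ∑ j, oneSubProj X i j *
      gradPhi (alphaAt κ γ σ α X Y wp wm t ω) (beta wp wm t ω) j) atTop
      (𝓝 (∑ j, oneSubProj X i j * gradPhi (alphaInf κ γ σ α X Y wp wm ω) b j)) :=
    fun i => tendsto_finsetSum _ fun j _ => (hg j).const_mul _
  exact ((PiLp.continuous_toLp 2 fun _ : Fin d => ℝ).tendsto _).comp (tendsto_pi_nhds.2 hsum)

section Law

variable {mΩ : MeasurableSpace Ω} {μ : Measure Ω} {ℱ : Filtration ℝ≥0 mΩ}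

namespace IsFlow

lemma stronglyAdapted_beta (hw : IsFlow ℱ μ κ γ σ α X Y B Bt wp wm) (t : ℝ≥0) :
    StronglyMeasurable[ℱ t] (beta wp wm t) := by
  have h : Continuous fun p : EuclideanSpace ℝ (Fin d) × EuclideanSpace ℝ (Fin d) =>
      (WithLp.toLp 2 fun i => p.1 i ^ 2 - p.2 i ^ 2 : EuclideanSpace ℝ (Fin d)) := by fun_prop
  exact h.comp_stronglyMeasurable ((hw.adapted_p t).prodMk (hw.adapted_m t))

lemma stronglyMeasurable_relNoise (hw : IsFlow ℱ μ κ γ σ α X Y B Bt wp wm) (i : Fin d)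
    (j : Fin n ⊕ Fin d) (t : ℝ≥0) :
    StronglyMeasurable[ℱ t] (relNoise κ γ σ X Y wp wm i j t) := by
  have hl := continuous_loss κ X Y
  rcases j with k | j
  · exact (show Continuous fun b => 2 * √(γ * loss κ X Y b) * normX X k i by
      fun_prop).comp_stronglyMeasurable (hw.stronglyAdapted_beta t)
  · exact (show Continuous fun b => 2 * σ * √(γ * loss κ X Y b) * (if j = i then 1 else 0) by
      fun_prop).comp_stronglyMeasurable (hw.stronglyAdapted_beta t)

lemma ae_continuous_beta (hw : IsFlow ℱ μ κ γ σ α X Y B Bt wp wm) :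
    ∀ᵐ ω ∂μ, Continuous fun t => beta wp wm t ω := by
  filter_upwards [hw.continuous_p, hw.continuous_m] with ω h1 h2
  exact continuous_beta h1 h2

lemma isItoProcess_p (hw : IsFlow ℱ μ κ γ σ α X Y B Bt wp wm) (i : Fin d) :
    IsItoProcess ℱ μ (Sum.elim B Bt)
      (fun j t ω => wp t ω i * relNoise κ γ σ X Y wp wm i j t ω)
      (fun t ω => wp t ω i * -drift X Y wp wm i t ω) (α i) (fun t ω => wp t ω i) where
  adapted s := (PiLp.continuous_apply 2 _ i).comp_stronglyMeasurable (hw.adapted_p s)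
  continuous := hw.continuous_p.mono fun ω h => (PiLp.continuous_apply 2 _ i).comp h
  drift_continuous := by
    filter_upwards [hw.continuous_p, hw.ae_continuous_beta] with ω h1 h2
    exact ((PiLp.continuous_apply 2 _ i).comp h1).mul (continuous_drift h2 i).neg
  isItoIntegral := by
    have h := hw.sde_p i
    rw [noise_eq] at h
    convert! h using 1
    funext t ω
    rw [sub_eq_add_neg, ← intervalIntegral.integral_neg]
    congr 2
    funext s
    ring

lemma isItoProcess_m (hw : IsFlow ℱ μ κ γ σ α X Y B Bt wp wm) (i : Fin d) :
    IsItoProcess ℱ μ (Sum.elim B Bt)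
      (fun j t ω => wm t ω i * -relNoise κ γ σ X Y wp wm i j t ω)
      (fun t ω => wm t ω i * drift X Y wp wm i t ω) (α i) (fun t ω => wm t ω i) where
  adapted s := (PiLp.continuous_apply 2 _ i).comp_stronglyMeasurable (hw.adapted_m s)
  continuous := hw.continuous_m.mono fun ω h => (PiLp.continuous_apply 2 _ i).comp h
  drift_continuous := by
    filter_upwards [hw.continuous_m, hw.ae_continuous_beta] with ω h1 h2
    exact ((PiLp.continuous_apply 2 _ i).comp h1).mul (continuous_drift h2 i)
  isItoIntegral := by
    have h := (hw.sde_m i).neg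
    rw [noise_eq] at h
    simp only [neg_neg, ← mul_neg] at h
    convert! h using 1
    funext t ω
    congr 2
    funext s
    ring

variable [IsProbabilityMeasure μ]

/-- The martingale parts of `w_{t,+}` and `w_{t,-}` cancel in the product, which therefore solves a
linear ordinary differential equation along every path. -/
lemma mul_eq_alphaAt_sq (hκ : 0 < κ) (hγ : 0 < γ) (hB : IsBrownian ℱ μ (Sum.elim B Bt))
    (hw : IsFlow ℱ μ κ γ σ α X Y B Bt wp wm) (i : Fin d) :
    ∀ᵐ ω ∂μ, ∀ t, wp t ω i * wm t ω i = alphaAt κ γ σ α X Y wp wm t ω i ^ 2 := by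
  have h := (hw.isItoProcess_p i).mul_eq hB (hw.isItoProcess_m i) (fun j s ω => by ring)
  filter_upwards [h, hw.init_p, hw.init_m, hw.continuous_p, hw.continuous_m] with ω h hp hm cp cm t
  have hβ := continuous_beta cp cm
  have hl : Continuous fun s : ℝ≥0 => loss κ X Y (beta wp wm s ω) :=
    (continuous_loss κ X Y).comp hβ
  have hu : Continuous fun s => wp s ω i * wm s ω i :=
    ((PiLp.continuous_apply 2 _ i).comp cp).mul ((PiLp.continuous_apply 2 _ i).comp cm)
  rw [alphaAt_sq]
  have := eq_mul_exp_of_integral_eq (c := α i * α i)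
    (q := fun s => 4 * γ * (((normX X)ᵀ * normX X) i i + σ ^ 2) * loss κ X Y (beta wp wm s ω))
    hu (by fun_prop) (fun t => ?_) t
  · rw [this, intervalIntegral.integral_const_mul]
  · rw [h t, hp i, hm i, sub_eq_add_neg, ← intervalIntegral.integral_neg]
    congr 2
    funext s
    rw [← sum_relNoise_sq hκ hγ, Finset.sum_mul, ← Finset.sum_neg_distrib]
    have e : wp s.toNNReal ω i * (wm s.toNNReal ω i * drift X Y wp wm i s.toNNReal ω)
        + wm s.toNNReal ω i * (wp s.toNNReal ω i * -drift X Y wp wm i s.toNNReal ω) = 0 := by ring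
    rw [e, zero_add]
    exact Finset.sum_congr rfl fun j _ => by ring

lemma pos (hκ : 0 < κ) (hγ : 0 < γ) (hα : ∀ i, 0 < α i) (hB : IsBrownian ℱ μ (Sum.elim B Bt))
    (hw : IsFlow ℱ μ κ γ σ α X Y B Bt wp wm) (i : Fin d) :
    ∀ᵐ ω ∂μ, ∀ t, 0 < wp t ω i ∧ 0 < wm t ω i := by
  -- A continuous path that starts at `α i > 0` and never vanishes stays positive.
  have key : ∀ x : ℝ≥0 → ℝ, Continuous x → 0 < x 0 → (∀ t, x t ≠ 0) → ∀ t, 0 < x t := by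
    intro x hx h0 hne t
    by_contra! hle
    obtain ⟨s, hs⟩ := mem_range_of_exists_le_of_exists_ge hx ⟨t, hle⟩ ⟨0, h0.le⟩
    exact hne s hs
  filter_upwards [hw.mul_eq_alphaAt_sq hκ hγ hB i, hw.init_p, hw.init_m, hw.continuous_p,
    hw.continuous_m] with ω h hp hm cp cm t
  have hne : ∀ t, wp t ω i * wm t ω i ≠ 0 := fun t => by
    rw [h t]
    exact (pow_pos (alphaAt_pos hα t ω i) 2).ne'
  exact ⟨key (fun t => wp t ω i) ((PiLp.continuous_apply 2 _ i).comp cp) (by rw [hp i]; exact hα i)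
      (fun t => left_ne_zero_of_mul (hne t)) t,
    key (fun t => wm t ω i) ((PiLp.continuous_apply 2 _ i).comp cm) (by rw [hm i]; exact hα i)
      (fun t => right_ne_zero_of_mul (hne t)) t⟩

/-- The stochastic integral of the relative noise is `2 ∇φ_{α_t}(β_t)` up to the integrated
drift. -/
lemma tendsto_sum_relNoise (hκ : 0 < κ) (hγ : 0 < γ) (hα : ∀ i, 0 < α i)
    (hB : IsBrownian ℱ μ (Sum.elim B Bt)) (hw : IsFlow ℱ μ κ γ σ α X Y B Bt wp wm) (i : Fin d)
    {t : ℝ≥0} {N : ℕ → ℕ} {τ : ℕ → ℕ → ℝ≥0} (hτ : IsRefining t N τ) :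
    TendstoInMeasure μ (fun m ω => ∑ k ∈ Finset.range (N m), ∑ j,
      relNoise κ γ σ X Y wp wm i j (τ m k) ω *
        (Sum.elim B Bt j (τ m (k + 1)) ω - Sum.elim B Bt j (τ m k) ω)) atTop
      (fun ω => 2 * gradPhi (alphaAt κ γ σ α X Y wp wm t ω) (beta wp wm t ω) i
        + ∫ s in (0 : ℝ)..t, drift X Y wp wm i s.toNNReal ω) := by
  refine ((hw.isItoProcess_p i).tendsto_log hB ((hw.pos hκ hγ hα hB i).mono
    fun ω h s => (h s).1) (fun j s => hw.stronglyMeasurable_relNoise i j s) hτ).congr_right ?_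
  filter_upwards [hw.pos hκ hγ hα hB i, hw.mul_eq_alphaAt_sq hκ hγ hB i, hw.init_p]
    with ω hpos hmul hp
  have hlog := congrArg Real.log (hmul t)
  rw [alphaAt_sq, Real.log_mul (hpos t).1.ne' (hpos t).2.ne',
    Real.log_mul (mul_pos (hα i) (hα i)).ne' (Real.exp_pos _).ne', Real.log_exp,
    Real.log_mul (hα i).ne' (hα i).ne'] at hlog
  have hgrad : gradPhi (alphaAt κ γ σ α X Y wp wm t ω) (beta wp wm t ω) i
      = 1 / 4 * (Real.log (wp t ω i) - Real.log (wm t ω i)) := by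
    rw [← arsinh_eq_log_sub_log (hpos t).1 (hpos t).2, hmul t]
    rfl
  rw [hgrad, hp i, intervalIntegral.integral_neg]
  simp only [sum_relNoise_sq hκ hγ, intervalIntegral.integral_const_mul]
  linarith

end IsFlow

lemma sum_oneSubProj_mul_normX (X : Matrix (Fin n) (Fin d) ℝ) (i : Fin d) (k : Fin n) :
    ∑ l, oneSubProj X i l * normX X k l = 0 := by
  have hmem : (WithLp.toLp 2 (normX X k) : EuclideanSpace ℝ (Fin d)) ∈ rowSpan X :=
    (rowSpan X).smul_mem (Real.sqrt n)⁻¹ (Submodule.subset_span ⟨k, rfl⟩)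
  exact sum_oneSubProj_mul_eq_zero X i hmem

/-- The drift lies in the row span. -/
lemma sum_oneSubProj_mul_drift (i : Fin d) (t : ℝ≥0) (ω : Ω) :
    ∑ l, oneSubProj X i l * drift X Y wp wm l t ω = 0 := by
  simp only [drift, Matrix.mulVec, dotProduct, Matrix.transpose_apply, Finset.mul_sum]
  rw [Finset.sum_comm]
  refine Finset.sum_eq_zero fun k _ => ?_
  simp only [← mul_assoc, ← Finset.sum_mul, sum_oneSubProj_mul_normX, zero_mul]

/-- Projecting the relative noise onto the orthogonal complement of the row span leaves the label
noise `B̃` only. -/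
lemma sum_oneSubProj_mul_relNoise (i : Fin d) (t : ℝ≥0) (ω : Ω) (v : Fin n ⊕ Fin d → ℝ) :
    ∑ l, 1 / 2 * oneSubProj X i l * ∑ j, relNoise κ γ σ X Y wp wm l j t ω * v j
      = ∑ j, σ * √(γ * loss κ X Y (beta wp wm t ω)) * oneSubProj X i j * v (Sum.inr j) := by
  simp only [Fintype.sum_sum_type, relNoise, mul_add, Finset.sum_add_distrib]
  have h1 : ∑ l, 1 / 2 * oneSubProj X i l * ∑ k, 2 * √(γ * loss κ X Y (beta wp wm t ω))
      * normX X k l * v (Sum.inl k) = 0 := by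
    simp only [Finset.mul_sum]
    rw [Finset.sum_comm]
    refine Finset.sum_eq_zero fun k _ => ?_
    have := sum_oneSubProj_mul_normX X i k
    calc _ = √(γ * loss κ X Y (beta wp wm t ω)) * v (Sum.inl k)
          * ∑ l, oneSubProj X i l * normX X k l := by
          rw [Finset.mul_sum]
          exact Finset.sum_congr rfl fun l _ => by ring
      _ = 0 := by rw [this, mul_zero]
  rw [h1, zero_add]
  refine Finset.sum_congr rfl fun l _ => ?_
  simp only [mul_ite, mul_one, mul_zero, ite_mul, zero_mul, Finset.sum_ite_eq', Finset.mem_univ,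
    if_true]
  ring

/-- Half of `1 - P`, applied to the stochastic integral of the relative noise, leaves
`σ ∫ √(γ L(β_s)) (1 - P) dB̃_s` and annihilates the integrated drift, so this Itô integral exists
and has the closed form `(1 - P) ∇φ_{α_t}(β_t)`. -/
lemma IsFlow.isPerturbation_perturbation [IsProbabilityMeasure μ] (hκ : 0 < κ) (hγ : 0 < γ)
    (hα : ∀ i, 0 < α i) (hB : IsBrownian ℱ μ (Sum.elim B Bt))
    (hw : IsFlow ℱ μ κ γ σ α X Y B Bt wp wm) :
    IsPerturbation ℱ μ κ γ σ X Y Bt wp wm (perturbation κ γ σ α X Y wp wm) := by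
  have hl := continuous_loss κ X Y
  have hadapt : ∀ i j t, StronglyMeasurable[ℱ t]
      (fun ω => σ * √(γ * loss κ X Y (beta wp wm t ω)) * oneSubProj X i j) := fun i j t =>
    (show Continuous fun b => σ * √(γ * loss κ X Y b) * oneSubProj X i j by
      fun_prop).comp_stronglyMeasurable (hw.stronglyAdapted_beta t)
  refine fun i => ⟨fun j t => hadapt i j t, fun j => ?_, ?_, fun t N τ hτ hmesh => ?_⟩
  · filter_upwards [hw.ae_continuous_beta] with ω hω
    fun_prop
  · filter_upwards [hw.ae_continuous_beta] with ω hω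
    exact (PiLp.continuous_apply 2 _ i).comp (continuous_perturbation hα hω)
  · have hm1 : ∀ j s, Measurable fun ω =>
        σ * √(γ * loss κ X Y (beta wp wm s ω)) * oneSubProj X i j := fun j s =>
      ((hadapt i j s).mono (ℱ.le s)).measurable
    have hm2 : ∀ j s, Measurable (Bt j s) := fun j s =>
      ((hB.adapted (Sum.inr j) s).mono (ℱ.le s)).measurable
    refine tendstoInMeasure_of_subseq
      (fun m => (Finset.measurable_sum _ fun k _ => Finset.measurable_sum _ fun j _ =>
        (hm1 j _).mul ((hm2 j _).sub (hm2 j _))).aestronglyMeasurable)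
      (fun l => hw.tendsto_sum_relNoise hκ hγ hα hB l ⟨hτ, hmesh⟩) ?_
    filter_upwards [hw.ae_continuous_beta] with ω hω ns hns hall
    have hlim := tendsto_finsetSum Finset.univ fun l _ =>
      (hall l).const_mul (1 / 2 * oneSubProj X i l)
    have hdrift : ∑ l, oneSubProj X i l * ∫ s in (0 : ℝ)..t, drift X Y wp wm l s.toNNReal ω
        = 0 := by
      simp only [← intervalIntegral.integral_const_mul]
      rw [← intervalIntegral.integral_finsetSum fun l _ => ?_]
      · simp [sum_oneSubProj_mul_drift]
      · exact (continuous_const.mul ((continuous_drift hω l).comp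
          continuous_real_toNNReal)).intervalIntegrable _ _
    have hval : ∑ l, 1 / 2 * oneSubProj X i l *
        (2 * gradPhi (alphaAt κ γ σ α X Y wp wm t ω) (beta wp wm t ω) l
          + ∫ s in (0 : ℝ)..t, drift X Y wp wm l s.toNNReal ω)
        = perturbation κ γ σ α X Y wp wm t ω i := by
      calc _ = ∑ l, oneSubProj X i l *
            gradPhi (alphaAt κ γ σ α X Y wp wm t ω) (beta wp wm t ω) l
            + 1 / 2 * ∑ l, oneSubProj X i l
              * ∫ s in (0 : ℝ)..t, drift X Y wp wm l s.toNNReal ω := by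
            rw [Finset.mul_sum, ← Finset.sum_add_distrib]
            exact Finset.sum_congr rfl fun l _ => by ring
        _ = _ := by rw [hdrift, mul_zero, add_zero]; rfl
    rw [hval] at hlim
    refine hlim.congr fun m => ?_
    simp only [Finset.mul_sum (Finset.range _)]
    rw [Finset.sum_comm]
    exact Finset.sum_congr rfl fun k _ => sum_oneSubProj_mul_relNoise i _ ω
      (fun j => Sum.elim B Bt j (τ (ns m) (k + 1)) ω - Sum.elim B Bt j (τ (ns m) k) ω)

/-- An Itô integral is determined by its integrand up to indistinguishability. -/
lemma IsItoIntegral.ae_forall_eq {ι : Type*} [Fintype ι] {W H : ι → ℝ≥0 → Ω → ℝ}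
    {I J : ℝ≥0 → Ω → ℝ} (hI : IsItoIntegral ℱ μ W H I) (hJ : IsItoIntegral ℱ μ W H J) :
    ∀ᵐ ω ∂μ, ∀ t, I t ω = J t ω := by
  refine ae_forall_eq_of_continuous hI.continuous hJ.continuous fun t => ?_
  have hτ := isRefining_equidist t
  exact tendstoInMeasure_ae_unique (hI.tendsto t _ _ hτ.subdivision hτ.mesh)
    (hJ.tendsto t _ _ hτ.subdivision hτ.mesh)

end Law

end Flow

end NoisyDLN

theorem proposition3 {n d : ℕ} {Ω : Type*} {mΩ : MeasurableSpace Ω}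
    (μ : Measure Ω) [IsProbabilityMeasure μ] (ℱ : Filtration ℝ≥0 mΩ)
    (X : Matrix (Fin n) (Fin d) ℝ) (Y : Fin n → ℝ)
    (κ γ σ : ℝ) (hκ : 0 < κ) (hγ : 0 < γ) (hσ : 0 ≤ σ)
    (α : Fin d → ℝ) (hα : ∀ i, 0 < α i)
    (B : Fin n → ℝ≥0 → Ω → ℝ) (Bt : Fin d → ℝ≥0 → Ω → ℝ)
    (hB : IsBrownian ℱ μ (Sum.elim B Bt))
    (wp wm : ℝ≥0 → Ω → EuclideanSpace ℝ (Fin d))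
    (hw : IsFlow ℱ μ κ γ σ α X Y B Bt wp wm) :
    (∃ R, IsPerturbation ℱ μ κ γ σ X Y Bt wp wm R) ∧
    ∀ R, IsPerturbation ℱ μ κ γ σ X Y Bt wp wm R →
      ∀ᵐ ω ∂μ, ∀ bInf, ConvergesTo κ X Y wp wm ω bInf →
        (∀ i, 0 < alphaInf κ γ σ α X Y wp wm ω i) ∧
        (∀ S : Set (EuclideanSpace ℝ (Fin d)), Bornology.IsBounded S → Convex ℝ S →
          ∃ m > 0, StrongConvexOn S m (phi (alphaInf κ γ σ α X Y wp wm ω))) ∧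
        ∃ rInf, Tendsto (fun t => R t ω) atTop (𝓝 rInf) ∧
          ∃ bStar, IsConstrainedMin X Y (phi (alphaInf κ γ σ α X Y wp wm ω)) bStar ∧
            (∀ b, IsConstrainedMin X Y (phi (alphaInf κ γ σ α X Y wp wm ω)) b → b = bStar) ∧
            ∀ (S : Set (EuclideanSpace ℝ (Fin d))) (m : ℝ), 0 < m → bStar ∈ S → bInf ∈ S →
              StrongConvexOn S m (phi (alphaInf κ γ σ α X Y wp wm ω)) →
              ‖bStar - bInf‖ ≤ 1 / m * ‖rInf‖ := by
  have hR₀ := hw.isPerturbation_perturbation hκ hγ hα hB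
  refine ⟨⟨_, hR₀⟩, fun R hR => ?_⟩
  filter_upwards [ae_all_iff.2 fun i => (hR i).ae_forall_eq (hR₀ i)] with ω hω bInf hconv
  have ha := fun i => alphaInf_pos (κ := κ) (γ := γ) (σ := σ) (X := X) (Y := Y) (wp := wp)
    (wm := wm) hα ω i
  have hRω : (fun t => R t ω) = fun t => perturbation κ γ σ α X Y wp wm t ω := by
    funext t
    ext i
    exact hω i t
  obtain ⟨bStar, hmin⟩ := exists_isConstrainedMin ha hconv.interpolates
  refine ⟨ha, fun S hS hS' => exists_strongConvexOn_phi ha hS hS', _,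
    hRω ▸ hconv.tendsto_perturbation hα, bStar, hmin, fun b hb => hmin.eq ha hb,
    fun S m hm hS hS' h => ?_⟩
  exact norm_sub_le_of_isConstrainedMin ha hm h hmin hconv.interpolates hS hS' fun i => rfl
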